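/- Write $\mathbb N=\{1,2,3,\dots\}$, $[l]=\{1,\dots,l\}$ and $(l,\infty)=\{l+1,l+2,\dots\}$. For $A\subseteq\mathbb N$ let $\underline{\mathrm{dens}}\,A=\liminf_{M\to\infty}\frac{|A\cap[1,M]|}{M}$, $\overline{\mathrm{dens}}\,A=\limsup_{M\to\infty}\frac{|A\cap[1,M]|}{M}$ and $\overline{\mathrm{Bd}}\,A=\limsup_{M\to\infty}\max_{k\ge1}\frac{|A\cap[k+1,k+M]|}{M}$, and let $\mathcal A_{ld},\mathcal A_{ud},\mathcal A_{uBd}$ be the families of sets $A\subseteq\mathbb N$ for which, respectively, $\underline{\mathrm{dens}}\,A>0$, $\overline{\mathrm{dens}}\,A>0$, $\overline{\mathrm{Bd}}\,A>0$. Let $1\le p<\infty$, $N\ge2$, and let $\ell^p(\mathbb N)$ be over $\mathbb K=\mathbb R$ or $\mathbb C$. For $s\in[N]$ let $f_s:\mathbb N\to\mathbb N$ be strictly increasing with $f_s(1)>1$, and let $w_s=(w_{s,j})_{j\ge1}$ be scalars with $\sup_j|w_{s,f_s(j)}|<\infty$, so that the unilateral pseudo-shift $T_s=T_{f_s,w_s}$,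 $(T_sx)_j=w_{s,f_s(j)}x_{f_s(j)}$, is a bounded operator on $\ell^p(\mathbb N)$. Put $W^s_{j,n}=\prod_{m=1}^n w_{s,f_s^m(j)}$, where $f_s^m$ is the $m$-th iterate of $f_s$, and for $i\in f_s^n(\mathbb N)$ let $f_s^{-n}(i)$ be the unique $j$ with $f_s^n(j)=i$. Let $\mathcal A\in\{\mathcal A_{uBd},\mathcal A_{ud},\mathcal A_{ld}\}$. The operators $T_1,\dots,T_N$ are called disjoint $\mathcal A$-hypercyclic if there is $x\in\ell^p(\mathbb N)$ such that for every non-empty open $U\subseteq\ell^p(\mathbb N)^N$ the set $\{n:(T_1^nx,\dots,T_N^nx)\in U\}$ belongs to $\mathcal A$. The family $\mathcal A$ is called $(f_s)_{s=1}^N$-weakly partition regular if for every sequence $(B_l)_{l\ge1}$ in $\mathcal A$ there is a sequence $(A_l)_{l\ge1}$ in $\mathcal A$ such that $A_l\subseteq B_l$ for all $l\ge1$ and, for all $l,k\ge1$, $m\in A_l$, $n\in A_k$ with $m\ne n$ and all $s,t\in[N]$, $f_s^m([l])\cap f_t^n([k])=\emptyset$. **Theorem.** Suppose that $\mathcal A$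 is $(f_s)_{s=1}^N$-weakly partition regular. Then $T_1,\dots,T_N$ are disjoint $\mathcal A$-hypercyclic if and only if there exist sets $A_k\in\mathcal A$, $k\ge1$, and positive reals $\varepsilon_k\to0$ such that 1. for any $j\ge1$ and $s\in[N]$, $\displaystyle\sum_{n\ge1}\frac1{|W^s_{j,n}|^p}<\infty$ (with $1/0=\infty$); 2. for any $1\le j\le l$, $k\ge1$, $n\in A_k$ and $s\ne t$ in $[N]$, $$\sum_{m\in A_l\setminus\{n\}:\ f_t^m(j)\in f_s^n((k,\infty))}\frac{|W^s_{f_s^{-n}(f_t^m(j)),n}|^p}{|W^t_{j,m}|^p}\le\varepsilon_l;$$ 3. for any $1\le j\le k<l$, $n\in A_l$ and $s\ne t$ in $[N]$, $$\sum_{m\in A_k:\ f_t^m(j)\in f_s^n((l,\infty))}\frac{|W^s_{f_s^{-n}(f_t^m(j)),n}|^p}{|W^t_{j,m}|^p}\le\varepsilon_l;$$ 4. for any $l\ge1$, any non-zero scalars $(a_{s,j})_{s\in[N],j\in[l]}$ and any $\varepsilon>0$ there is $L\ge l$ such that for any $s\ne t$ in $[N]$ and any $n\in A_L$: (a) for any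 $j\in f_t^n([l])\cap f_s^n([l])$, $\displaystyle\left|\frac{W^s_{f_s^{-n}(j),n}}{W^t_{f_t^{-n}(j),n}}-\frac{a_{s,f_s^{-n}(j)}}{a_{t,f_t^{-n}(j)}}\right|\le\varepsilon$; (b) for any $j\in f_t^n([l])\cap f_s^n((l,\infty))$, $\displaystyle\frac{|W^s_{f_s^{-n}(j),n}|}{|W^t_{f_t^{-n}(j),n}|}\le\varepsilon$. -/

import Mathlib

open scoped ENNReal
open Filter Topology

noncomputable section

namespace DisjointShifts

/-! Conventions: coordinates of sequences, and the indices of sequences of sets, run over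
`{1, 2, 3, …}`, which is `ℕ+`. Iteration counts (times) are elements of `ℕ`; the time `0` is
ignored by all the densities below. -/

/-- Lower density of a set of natural numbers. -/
def lowerDensity (A : Set ℕ) : ℝ :=
  liminf (fun M : ℕ => ((A ∩ Set.Icc 1 M).ncard : ℝ) / M) atTop

/-- Upper density of a set of natural numbers. -/
def upperDensity (A : Set ℕ) : ℝ :=
  limsup (fun M : ℕ => ((A ∩ Set.Icc 1 M).ncard : ℝ) / M) atTop

/-- Upper Banach density of a set of natural numbers. -/
def upperBanachDensity (A : Set ℕ) : ℝ :=
  limsup (fun M : ℕ => ⨆ k : ℕ+, ((A ∩ Set.Icc (k + 1 : ℕ) (k + M)).ncard : ℝ) / M) atTop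

/-- The family of sets of positive lower density. -/
def familyLD : Set (Set ℕ) := {A | 0 < lowerDensity A}

/-- The family of sets of positive upper density. -/
def familyUD : Set (Set ℕ) := {A | 0 < upperDensity A}

/-- The family of sets of positive upper Banach density. -/
def familyUBD : Set (Set ℕ) := {A | 0 < upperBanachDensity A}

section Hypercyclic

variable {𝕜 : Type*} [NormedField 𝕜] {E : Type*} [NormedAddCommGroup E] [NormedSpace 𝕜 E]

/-- `x` is an `𝒜`-hypercyclic vector for `T`: every non-empty open set is visited by the orbit
of `x` along a set of times that belongs to `𝒜`. -/
def IsHypercyclicVector (𝒜 : Set (Set ℕ)) (T : E →L[𝕜] E) (x : E) : Prop :=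
  ∀ U : Set E, IsOpen U → U.Nonempty → {n : ℕ | (T ^ n) x ∈ U} ∈ 𝒜

/-- `T₁, …, T_N` are disjoint `𝒜`-hypercyclic: the direct sum operator on `E ^ N` has an
`𝒜`-hypercyclic vector on the diagonal. -/
def DisjointHypercyclic (𝒜 : Set (Set ℕ)) {N : ℕ} (T : Fin N → E →L[𝕜] E) : Prop :=
  ∃ x : E, IsHypercyclicVector 𝒜 (ContinuousLinearMap.piMap T) (fun _ : Fin N => x)

end Hypercyclic

/-- The family `𝒜` is `(f₁, …, f_N)`-weakly partition regular; `Set.Iic l` is `{1, …, l}`. -/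
def WeaklyPartitionRegular (𝒜 : Set (Set ℕ)) {N : ℕ} (f : Fin N → ℕ+ → ℕ+) : Prop :=
  ∀ B : ℕ+ → Set ℕ, (∀ l, B l ∈ 𝒜) →
    ∃ A : ℕ+ → Set ℕ, (∀ l, A l ∈ 𝒜) ∧ (∀ l, A l ⊆ B l) ∧
      ∀ l k : ℕ+, ∀ m ∈ A l, ∀ n ∈ A k, m ≠ n → ∀ s t : Fin N,
        ((f s)^[m] '' Set.Iic l) ∩ ((f t)^[n] '' Set.Iic k) = ∅

/-- The preimage `f⁻ⁿ(j)` of `j` under the `n`-th iterate of an injective map `f`; it is only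
used for `j` in the range of that iterate. -/
def iterInv (f : ℕ+ → ℕ+) (n : ℕ) (j : ℕ+) : ℕ+ := Function.invFun (f^[n]) j

section Shift

variable {𝕜 : Type*} [RCLike 𝕜]

/-- The weight product `W_{j,n} = ∏_{m=1}^n w_{f^m(j)}`. -/
def weightProd (f : ℕ+ → ℕ+) (w : ℕ+ → 𝕜) (j : ℕ+) (n : ℕ) : 𝕜 :=
  ∏ m ∈ Finset.Icc 1 n, w (f^[m] j)

lemma pseudoShift_aux (p : ℝ≥0∞) [Fact (1 ≤ p)] {f : ℕ+ → ℕ+} (hf : StrictMono f)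
    {w : ℕ+ → 𝕜} {C : ℝ} (hC : ∀ j, ‖w (f j)‖ ≤ C) (x : lp (fun _ : ℕ+ => 𝕜) p) :
    ∃ h : Memℓp (fun j => w (f j) * x (f j)) p,
      ‖(⟨_, h⟩ : lp (fun _ : ℕ+ => 𝕜) p)‖ ≤ C * ‖x‖ := by
  have hC0 : 0 ≤ C := (norm_nonneg _).trans (hC 1)
  have hle : ∀ j, ‖w (f j) * x (f j)‖ ≤ C * ‖x (f j)‖ := fun j => by
    rw [norm_mul]
    exact mul_le_mul_of_nonneg_right (hC j) (norm_nonneg _)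
  have hp1 : (1 : ℝ≥0∞) ≤ p := Fact.out
  rcases eq_or_ne p ⊤ with rfl | hp
  · have hb : ∀ j, ‖w (f j) * x (f j)‖ ≤ C * ‖x‖ := fun j =>
      (hle j).trans (mul_le_mul_of_nonneg_left (lp.norm_apply_le_norm (by simp) x _) hC0)
    have h : Memℓp (fun j => w (f j) * x (f j)) ⊤ :=
      memℓp_infty ⟨C * ‖x‖, by rintro _ ⟨j, rfl⟩; exact hb j⟩
    exact ⟨h, lp.norm_le_of_forall_le (mul_nonneg hC0 (norm_nonneg _)) hb⟩
  · have hp0 : 0 < p.toReal := ENNReal.toReal_pos (by positivity) hp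
    have hx : Summable fun j => ‖x j‖ ^ p.toReal := (lp.memℓp x).summable hp0
    have hxf : Summable fun j => ‖x (f j)‖ ^ p.toReal := hx.comp_injective hf.injective
    have hle' : ∀ j, ‖w (f j) * x (f j)‖ ^ p.toReal ≤ C ^ p.toReal * ‖x (f j)‖ ^ p.toReal :=
      fun j => by
        rw [← Real.mul_rpow hC0 (norm_nonneg _)]
        exact Real.rpow_le_rpow (norm_nonneg _) (hle j) hp0.le
    have hs : Summable fun j => ‖w (f j) * x (f j)‖ ^ p.toReal :=
      Summable.of_nonneg_of_le (fun j => by positivity) hle' (hxf.mul_left _)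
    refine ⟨memℓp_gen hs, lp.norm_le_of_tsum_le hp0 (by positivity) ?_⟩
    calc ∑' j, ‖w (f j) * x (f j)‖ ^ p.toReal
        ≤ ∑' j, C ^ p.toReal * ‖x (f j)‖ ^ p.toReal := hs.tsum_le_tsum hle' (hxf.mul_left _)
      _ = C ^ p.toReal * ∑' j, ‖x (f j)‖ ^ p.toReal := tsum_mul_left
      _ ≤ C ^ p.toReal * ∑' j, ‖x j‖ ^ p.toReal := by
          refine mul_le_mul_of_nonneg_left ?_ (by positivity)
          exact tsum_comp_le_tsum_of_inj hx (fun j => by positivity) hf.injective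
      _ = (C * ‖x‖) ^ p.toReal := by
          rw [Real.mul_rpow hC0 (norm_nonneg _), lp.norm_rpow_eq_tsum hp0]

/-- The unilateral pseudo-shift `T_{f,w}` on `ℓ^p`: the continuous linear operator
`(T x)_j = w_{f(j)} x_{f(j)}`, for strictly increasing `f` and weights that are bounded along
the range of `f`. -/
def pseudoShift (p : ℝ≥0∞) [Fact (1 ≤ p)] (f : ℕ+ → ℕ+) (hf : StrictMono f)
    (w : ℕ+ → 𝕜) (hw : BddAbove (Set.range fun j => ‖w (f j)‖)) :
    lp (fun _ : ℕ+ => 𝕜) p →L[𝕜] lp (fun _ : ℕ+ => 𝕜) p :=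
  LinearMap.mkContinuousOfExistsBound
    { toFun := fun x => ⟨fun j => w (f j) * x (f j),
        (pseudoShift_aux p hf (fun j => hw.choose_spec ⟨j, rfl⟩) x).choose⟩
      map_add' := fun x y => by
        ext j
        exact mul_add (w (f j)) (x (f j)) (y (f j))
      map_smul' := fun c x => by
        ext j
        simp [mul_left_comm] }
    ⟨hw.choose, fun x =>
      (pseudoShift_aux p hf (fun j => hw.choose_spec ⟨j, rfl⟩) x).choose_spec⟩

lemma pseudoShift_apply (p : ℝ≥0∞) [Fact (1 ≤ p)] (f : ℕ+ → ℕ+) (hf : StrictMono f)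
    (w : ℕ+ → 𝕜) (hw : BddAbove (Set.range fun j => ‖w (f j)‖))
    (x : lp (fun _ : ℕ+ => 𝕜) p) (j : ℕ+) :
    pseudoShift p f hf w hw x j = w (f j) * x (f j) := rfl

end Shift

end DisjointShifts

end

/-! Necessity. Let x be a disjoint hypercyclic vector. `exists_targets` supplies targets y_k
supported on [1, k], with entries of modulus at least k + 2, whose ratios approximate every array of
non-zero scalars. Let A_k be the set of times n at which T_s^n x is within 1/(k+1) of y_{k,s} for
all s. For n in A_k, the number W^s_{i,n} x(f_s^n(i)) is large if i ≤ k, and is an entry of a vector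
of small norm if i > k. At a common position f_s^n(i) = f_t^m(j) the coordinate of x cancels from
the quotient of two such numbers and leaves W^s_{i,n} / W^t_{j,m}. Small over large gives (2) and
(3) (`tsum_weight_ratio_le`), and ratios of targets give (4).

For (1), if n and n + h lie in A_j, the error vector at time n has an entry of modulus at least
1/|W_{j,h}|. This bounds the sum of 1/|W_{j,h}|^p only over return times h.
`summable_of_bounded_returns` passes to all h: averaging over n with a shift-invariant mean weights
each h by the measure of A ∩ (A - h), this measure is bounded below along a syndetic set of h, and
bounded weights keep 1/|W_{j,h}|^p from dropping by more than a fixed factor per step.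

Sufficiency. Weak partition regularity shrinks A_k to collision-free sets C_k. For a dense sequence
of tuples a_r without zero entries, choose separated sets E_r inside C_{L_r} (`exists_separated`)
and put a_{r,t,j} / W^t_{j,m} at position f_t^m(j) for m in E_r, j ≤ l_r. By `entry_error`, at a
time n in E_r each wrong entry of T_s^n x has one of three causes: a collision at the same time with
t ≠ s, controlled by (4); another time with t ≠ s, controlled by (2) and (3); a later time with t =
s, controlled by the tail of (1). `exists_parameters` makes the total O(2^{-r}). -/

namespace DisjointShifts

/-! ### Counting elements of a set in an interval -/

lemma ncard_inter_Icc_le (A : Set ℕ) (a M : ℕ) : (A ∩ Set.Icc (a + 1) (a + M)).ncard ≤ M := by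
  calc (A ∩ Set.Icc (a + 1) (a + M)).ncard ≤ (Set.Icc (a + 1) (a + M)).ncard :=
        Set.ncard_le_ncard Set.inter_subset_right (Set.finite_Icc _ _)
    _ = M := by
        rw [← Finset.coe_Icc, Set.ncard_coe_finset, Nat.card_Icc]; omega

lemma ncard_inter_div_nonneg (A : Set ℕ) (a b M : ℕ) :
    (0 : ℝ) ≤ ((A ∩ Set.Icc a b).ncard : ℝ) / M := by positivity

lemma ncard_inter_div_le_one (A : Set ℕ) (a M : ℕ) :
    ((A ∩ Set.Icc (a + 1) (a + M)).ncard : ℝ) / M ≤ 1 :=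
  div_le_one_of_le₀ (by exact_mod_cast ncard_inter_Icc_le A a M) (by positivity)

lemma ncard_inter_Icc_shift (A : Set ℕ) (a M d : ℕ) :
    (A ∩ Set.Icc (a + 1) (a + (d + M))).ncard ≤
      d + (A ∩ Set.Icc (a + d + 1) (a + d + M)).ncard := by
  have h : A ∩ Set.Icc (a + 1) (a + (d + M)) ⊆
      (A ∩ Set.Icc (a + 1) (a + d)) ∪ (A ∩ Set.Icc (a + d + 1) (a + d + M)) := by
    rintro n ⟨hn, h1, h2⟩
    rcases le_or_gt n (a + d) with h | h
    · exact Or.inl ⟨hn, h1, h⟩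
    · exact Or.inr ⟨hn, h, by omega⟩
  calc _ ≤ _ := Set.ncard_le_ncard h (((Set.finite_Icc _ _).inter_of_right _).union
        ((Set.finite_Icc _ _).inter_of_right _))
    _ ≤ _ := Set.ncard_union_le _ _
    _ ≤ _ := Nat.add_le_add_right (ncard_inter_Icc_le A a d) _

open Classical in
lemma count_add_ncard_inter_Icc (A : Set ℕ) (a M : ℕ) :
    Nat.count (· ∈ A) (a + 1) + (A ∩ Set.Icc (a + 1) (a + M)).ncard =
      Nat.count (· ∈ A) (a + M + 1) := by
  induction M with
  | zero => simp
  | succ M ih =>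
    rw [show a + (M + 1) + 1 = (a + M + 1) + 1 by ring, Nat.count_succ _ (a + M + 1), ← ih]
    by_cases h : a + M + 1 ∈ A
    · have : A ∩ Set.Icc (a + 1) (a + (M + 1)) =
          insert (a + M + 1) (A ∩ Set.Icc (a + 1) (a + M)) := by
        ext n
        simp only [Set.mem_inter_iff, Set.mem_Icc, Set.mem_insert_iff]
        constructor
        · rintro ⟨h1, h2, h3⟩
          rcases eq_or_ne n (a + M + 1) with h4 | h4
          · exact Or.inl h4
          · exact Or.inr ⟨h1, h2, by omega⟩
        · rintro (rfl | ⟨h1, h2, h3⟩)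
          · exact ⟨h, by omega, by omega⟩
          · exact ⟨h1, h2, by omega⟩
      rw [this, Set.ncard_insert_of_notMem (by simp) ((Set.finite_Icc _ _).inter_of_right _)]
      rw [if_pos h, add_assoc]
    · have : A ∩ Set.Icc (a + 1) (a + (M + 1)) = A ∩ Set.Icc (a + 1) (a + M) := by
        ext n
        simp only [Set.mem_inter_iff, Set.mem_Icc]
        constructor
        · rintro ⟨h1, h2, h3⟩
          refine ⟨h1, h2, ?_⟩
          rcases eq_or_ne n (a + M + 1) with rfl | h4
          · exact absurd h1 h
          · omega
        · rintro ⟨h1, h2, h3⟩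
          exact ⟨h1, h2, by omega⟩
      rw [this, if_neg h, add_zero]

/-! ### Characterisations of the three families -/

/-- The two bounds keep the real-valued limsup from taking its default value. -/
lemma pos_limsup_iff {u : ℕ → ℝ} (h0 : ∀ n, 0 ≤ u n) (h1 : ∀ n, u n ≤ 1) :
    0 < limsup u atTop ↔ ∃ δ > 0, ∃ᶠ n in atTop, δ ≤ u n := by
  have hb : IsBoundedUnder (· ≤ ·) atTop u := isBoundedUnder_of ⟨1, h1⟩
  have hb' : IsBoundedUnder (· ≥ ·) atTop u := isBoundedUnder_of ⟨0, h0⟩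
  constructor
  · intro h
    obtain ⟨δ, hδ, hδ'⟩ := exists_between h
    exact ⟨δ, hδ, (frequently_lt_of_lt_limsup hb'.isCoboundedUnder_le hδ').mono
      fun n hn => hn.le⟩
  · rintro ⟨δ, hδ, h⟩
    exact hδ.trans_le (le_limsup_of_frequently_le h hb)

lemma pos_liminf_iff {u : ℕ → ℝ} (h0 : ∀ n, 0 ≤ u n) (h1 : ∀ n, u n ≤ 1) :
    0 < liminf u atTop ↔ ∃ δ > 0, ∀ᶠ n in atTop, δ ≤ u n := by
  have hb : IsBoundedUnder (· ≤ ·) atTop u := isBoundedUnder_of ⟨1, h1⟩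
  have hb' : IsBoundedUnder (· ≥ ·) atTop u := isBoundedUnder_of ⟨0, h0⟩
  constructor
  · intro h
    obtain ⟨δ, hδ, hδ'⟩ := exists_between h
    exact ⟨δ, hδ, (eventually_lt_of_lt_liminf hδ' hb').mono fun n hn => hn.le⟩
  · rintro ⟨δ, hδ, h⟩
    exact hδ.trans_le (le_liminf_of_le hb.isCoboundedUnder_ge h)

lemma mem_familyUD_iff {A : Set ℕ} :
    A ∈ familyUD ↔ ∃ δ : ℝ, 0 < δ ∧ ∃ᶠ M : ℕ in atTop, δ * M ≤ (A ∩ Set.Icc 1 M).ncard := by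
  refine (pos_limsup_iff (fun n => ncard_inter_div_nonneg A 1 n n)
    (fun n => by simpa using ncard_inter_div_le_one A 0 n)).trans ?_
  refine exists_congr fun δ => and_congr_right fun hδ => ?_
  refine frequently_congr ((eventually_gt_atTop 0).mono fun M hM => ?_)
  rw [le_div_iff₀ (by exact_mod_cast hM)]

lemma mem_familyLD_iff {A : Set ℕ} :
    A ∈ familyLD ↔ ∃ δ : ℝ, 0 < δ ∧ ∀ᶠ M : ℕ in atTop, δ * M ≤ (A ∩ Set.Icc 1 M).ncard := by
  refine (pos_liminf_iff (fun n => ncard_inter_div_nonneg A 1 n n)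
    (fun n => by simpa using ncard_inter_div_le_one A 0 n)).trans ?_
  refine exists_congr fun δ => and_congr_right fun hδ => ?_
  refine eventually_congr ((eventually_gt_atTop 0).mono fun M hM => ?_)
  rw [le_div_iff₀ (by exact_mod_cast hM)]

/-- Cutting the first m places off a long window loses at most m elements, which costs at most half
of the density. Windows may thus start arbitrarily far out, so it is immaterial whether the shift
`a` starts at 0 or at 1. -/
lemma exists_far_window {A : Set ℕ} {δ : ℝ} (hδ : 0 < δ)
    (h : ∀ m : ℕ, ∃ M ≥ m, ∃ a : ℕ, δ * M ≤ (A ∩ Set.Icc (a + 1) (a + M)).ncard) (m : ℕ) :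
    ∃ M ≥ m, ∃ a ≥ m, δ / 2 * M ≤ ((A ∩ Set.Icc (a + 1) (a + M)).ncard : ℝ) := by
  obtain ⟨q, hq⟩ := exists_nat_ge (2 * m / δ)
  obtain ⟨M, hM, a, ha⟩ := h (2 * m + q)
  obtain ⟨M', rfl⟩ : ∃ M', M = m + M' := ⟨M - m, by omega⟩
  refine ⟨M', by omega, a + m, by omega, ?_⟩
  have h1 := ncard_inter_Icc_shift A a M' m
  have h1' : ((A ∩ Set.Icc (a + 1) (a + (m + M'))).ncard : ℝ) ≤
      m + (A ∩ Set.Icc (a + m + 1) (a + m + M')).ncard := by exact_mod_cast h1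
  have h2 : (2 : ℝ) * m + q ≤ m + M' := by exact_mod_cast hM
  rw [div_le_iff₀ hδ] at hq
  push_cast at ha
  have hm : (0 : ℝ) ≤ m := by positivity
  nlinarith

lemma mem_familyUBD_iff {A : Set ℕ} :
    A ∈ familyUBD ↔ ∃ δ : ℝ, 0 < δ ∧ ∀ m : ℕ, ∃ M ≥ m, ∃ a ≥ m,
      δ * M ≤ (A ∩ Set.Icc (a + 1) (a + M)).ncard := by
  have hbd : ∀ M : ℕ, BddAbove (Set.range fun k : ℕ+ =>
      ((A ∩ Set.Icc (k + 1 : ℕ) (k + M)).ncard : ℝ) / M) := fun M =>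
    ⟨1, by rintro _ ⟨k, rfl⟩; exact ncard_inter_div_le_one A k M⟩
  refine (pos_limsup_iff (fun M => Real.iSup_nonneg fun k : ℕ+ => ncard_inter_div_nonneg A _ _ M)
    (fun M => ciSup_le fun k : ℕ+ => ncard_inter_div_le_one A k M)).trans ?_
  constructor
  · rintro ⟨δ, hδ, h⟩
    -- One halving selects a single window below the supremum; the other moves it far out.
    refine ⟨δ / 2 / 2, by positivity, exists_far_window (by positivity) fun m => ?_⟩
    obtain ⟨M, hM, hle⟩ := frequently_atTop.1 h (m + 1)
    obtain ⟨k, hk⟩ := exists_lt_of_lt_ciSup ((half_lt_self hδ).trans_le hle)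
    refine ⟨M, by omega, k, ?_⟩
    have hM0 : (0 : ℝ) < M := by exact_mod_cast (show 0 < M by omega)
    rw [lt_div_iff₀ hM0] at hk
    exact hk.le
  · rintro ⟨δ, hδ, h⟩
    refine ⟨δ, hδ, frequently_atTop.2 fun m => ?_⟩
    obtain ⟨M, hM, a, ha, hle⟩ := h (m + 1)
    have hM0 : (0 : ℝ) < M := by exact_mod_cast (show 0 < M by omega)
    refine ⟨M, by omega, le_trans ?_ (le_ciSup (hbd M) ⟨a, by omega⟩)⟩
    rw [le_div_iff₀ hM0]
    exact hle

lemma familyLD_subset_familyUD : familyLD ⊆ familyUD := by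
  intro A hA
  obtain ⟨δ, hδ, h⟩ := mem_familyLD_iff.1 hA
  exact mem_familyUD_iff.2 ⟨δ, hδ, h.frequently⟩

lemma familyUD_subset_familyUBD : familyUD ⊆ familyUBD := by
  intro A hA
  obtain ⟨δ, hδ, h⟩ := mem_familyUD_iff.1 hA
  refine mem_familyUBD_iff.2 ⟨δ / 2, by positivity, exists_far_window hδ fun m => ?_⟩
  obtain ⟨M, hM, hle⟩ := frequently_atTop.1 h m
  exact ⟨M, hM, 0, by simpa using hle⟩

/-- If `A` contains, up to a bounded error, a fixed proportion of `B` in each interval, then `A`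
belongs to each of the three families that contain `B`. -/
lemma mem_family_of_proportion {𝒜 : Set (Set ℕ)}
    (h𝒜 : 𝒜 = familyUBD ∨ 𝒜 = familyUD ∨ 𝒜 = familyLD) {A B : Set ℕ} (hB : B ∈ 𝒜) {c C : ℝ}
    (hc : 0 < c) (h : ∀ a M : ℕ, c * (B ∩ Set.Icc (a + 1) (a + M)).ncard ≤
      (A ∩ Set.Icc (a + 1) (a + M)).ncard + C) : A ∈ 𝒜 := by
  have key : ∀ δ : ℝ, 0 < δ → ∃ m : ℕ, ∀ a M : ℕ, m ≤ M →
      δ * M ≤ (B ∩ Set.Icc (a + 1) (a + M)).ncard →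
      c * δ / 2 * M ≤ (A ∩ Set.Icc (a + 1) (a + M)).ncard := by
    intro δ hδ
    obtain ⟨q, hq⟩ := exists_nat_ge (2 * C / (c * δ))
    refine ⟨q, fun a M hM hle => ?_⟩
    have h1 := h a M
    rw [div_le_iff₀ (by positivity)] at hq
    have hM' : (q : ℝ) ≤ M := by exact_mod_cast hM
    have h2 : c * (δ * M) ≤ c * (B ∩ Set.Icc (a + 1) (a + M)).ncard :=
      mul_le_mul_of_nonneg_left hle hc.le
    have h3 : (q : ℝ) * (c * δ) ≤ M * (c * δ) := mul_le_mul_of_nonneg_right hM' (by positivity)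
    linarith
  rcases h𝒜 with rfl | rfl | rfl
  · obtain ⟨δ, hδ, hw⟩ := mem_familyUBD_iff.1 hB
    obtain ⟨q, hq⟩ := key δ hδ
    refine mem_familyUBD_iff.2 ⟨c * δ / 2, by positivity, fun m => ?_⟩
    obtain ⟨M, hM, a, ha, hle⟩ := hw (m + q)
    exact ⟨M, by omega, a, by omega, hq a M (by omega) hle⟩
  · obtain ⟨δ, hδ, hw⟩ := mem_familyUD_iff.1 hB
    obtain ⟨q, hq⟩ := key δ hδ
    refine mem_familyUD_iff.2 ⟨c * δ / 2, by positivity,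
      (hw.and_eventually (eventually_ge_atTop q)).mono fun M hM => ?_⟩
    simpa using hq 0 M hM.2 (by simpa using hM.1)
  · obtain ⟨δ, hδ, hw⟩ := mem_familyLD_iff.1 hB
    obtain ⟨q, hq⟩ := key δ hδ
    refine mem_familyLD_iff.2 ⟨c * δ / 2, by positivity,
      (hw.and (eventually_ge_atTop q)).mono fun M hM => ?_⟩
    simpa using hq 0 M hM.2 (by simpa using hM.1)

lemma family_subset_familyUBD {𝒜 : Set (Set ℕ)}
    (h𝒜 : 𝒜 = familyUBD ∨ 𝒜 = familyUD ∨ 𝒜 = familyLD) : 𝒜 ⊆ familyUBD := by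
  rcases h𝒜 with rfl | rfl | rfl
  · exact subset_rfl
  · exact familyUD_subset_familyUBD
  · exact familyLD_subset_familyUD.trans familyUD_subset_familyUBD

lemma family_mono {𝒜 : Set (Set ℕ)}
    (h𝒜 : 𝒜 = familyUBD ∨ 𝒜 = familyUD ∨ 𝒜 = familyLD) {A B : Set ℕ} (hB : B ∈ 𝒜)
    (h : B ⊆ A) : A ∈ 𝒜 := by
  refine mem_family_of_proportion h𝒜 hB (c := 1) (C := 0) one_pos fun a M => ?_
  rw [one_mul, add_zero]
  exact_mod_cast Set.ncard_le_ncard (Set.inter_subset_inter_left _ h)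
    ((Set.finite_Icc _ _).inter_of_right _)

lemma diff_Iio_mem_family {𝒜 : Set (Set ℕ)}
    (h𝒜 : 𝒜 = familyUBD ∨ 𝒜 = familyUD ∨ 𝒜 = familyLD) {B : Set ℕ} (hB : B ∈ 𝒜) (m : ℕ) :
    B \ Set.Iio m ∈ 𝒜 := by
  refine mem_family_of_proportion h𝒜 hB (c := 1) (C := m) one_pos fun a M => ?_
  rw [one_mul]
  have h : B ∩ Set.Icc (a + 1) (a + M) ⊆
      ((B \ Set.Iio m) ∩ Set.Icc (a + 1) (a + M)) ∪ Set.Iio m := by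
    rintro n ⟨h1, h2⟩
    rcases lt_or_ge n m with h | h
    · exact Or.inr h
    · exact Or.inl ⟨⟨h1, not_lt.2 h⟩, h2⟩
  have h2 := (Set.ncard_le_ncard h (((Set.finite_Icc _ _).inter_of_right _).union
    (Set.finite_Iio m))).trans (Set.ncard_union_le _ _)
  have h3 : (Set.Iio m).ncard = m := by
    rw [← Finset.coe_Iio, Set.ncard_coe_finset, Nat.card_Iio]
  rw [h3] at h2
  exact_mod_cast h2

/-! ### Thinning a set -/

open Classical in
/-- Every `K`-th element of `B`. -/
def thin (K : ℕ) (B : Set ℕ) : Set ℕ := {n | n ∈ B ∧ K ∣ Nat.count (· ∈ B) n}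

lemma thin_subset (K : ℕ) (B : Set ℕ) : thin K B ⊆ B := fun _ h => h.1

/-- The ranks of m and n in B are distinct multiples of K, and rank grows by at most one per unit
step. -/
lemma add_le_of_mem_thin {K : ℕ} {B : Set ℕ} {m n : ℕ} (hm : m ∈ thin K B)
    (hn : n ∈ thin K B) (h : m < n) : m + K ≤ n := by
  classical
  have h1 : Nat.count (· ∈ B) m < Nat.count (· ∈ B) n := Nat.count_strict_mono hm.1 h
  obtain ⟨a, ha⟩ := hm.2
  obtain ⟨b, hb⟩ := hn.2
  have h2 : Nat.count (· ∈ B) n ≤ Nat.count (· ∈ B) m + (n - m) := by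
    conv_lhs => rw [show n = m + (n - m) by omega, Nat.count_add]
    exact Nat.add_le_add_left (Nat.count_le _) _
  have h3 : a < b := by
    by_contra hab
    have : K * b ≤ K * a := Nat.mul_le_mul_left _ (not_lt.1 hab)
    lia
  have h4 : K * (a + 1) ≤ K * b := Nat.mul_le_mul_left _ h3
  rw [mul_add] at h4
  lia

open Classical in
-- The quotient is a rounding up: the element of rank 0 is kept.
lemma count_thin {K : ℕ} (hK : 0 < K) (B : Set ℕ) (b : ℕ) :
    Nat.count (· ∈ thin K B) b = (Nat.count (· ∈ B) b + (K - 1)) / K := by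
  induction b with
  | zero => simp [Nat.div_eq_of_lt (show K - 1 < K by omega)]
  | succ b ih =>
    rw [Nat.count_succ, Nat.count_succ, ih]
    by_cases hb : b ∈ B
    · have h1 : Nat.count (· ∈ B) b + 1 + (K - 1) = Nat.count (· ∈ B) b + (K - 1) + 1 := by ring
      simp only [hb, if_true, h1]
      rw [Nat.succ_div]
      have h2 : K ∣ Nat.count (· ∈ B) b + (K - 1) + 1 ↔ b ∈ thin K B := by
        rw [show Nat.count (· ∈ B) b + (K - 1) + 1 = Nat.count (· ∈ B) b + K by omega]
        simp [thin, hb]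
      simp only [h2]
    · have h2 : b ∉ thin K B := fun h => hb h.1
      simp [hb, h2]

lemma ncard_thin_le {K : ℕ} (hK : 0 < K) (B : Set ℕ) (a M : ℕ) :
    ((thin K B ∩ Set.Icc (a + 1) (a + M)).ncard : ℝ) ≤ M / K + 1 := by
  classical
  have h1 := count_add_ncard_inter_Icc (thin K B) a M
  have h2 := count_add_ncard_inter_Icc B a M
  have h3 := ncard_inter_Icc_le B a M
  rw [count_thin hK, count_thin hK] at h1
  have hK' : (0 : ℝ) < K := by exact_mod_cast hK
  have e1 := Nat.lt_mul_div_succ (Nat.count (· ∈ B) (a + 1) + (K - 1)) hK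
  have e2 := Nat.mul_div_le (Nat.count (· ∈ B) (a + M + 1) + (K - 1)) K
  rw [← h1] at e2
  rw [div_add_one hK'.ne', le_div_iff₀ hK']
  have : K * (thin K B ∩ Set.Icc (a + 1) (a + M)).ncard ≤ M + K := by
    rw [mul_add] at e1 e2
    lia
  rw [mul_comm]
  exact_mod_cast this

lemma le_ncard_thin {K : ℕ} (hK : 0 < K) (B : Set ℕ) (a M : ℕ) :
    (1 / K : ℝ) * (B ∩ Set.Icc (a + 1) (a + M)).ncard ≤
      (thin K B ∩ Set.Icc (a + 1) (a + M)).ncard + 1 := by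
  classical
  have h1 := count_add_ncard_inter_Icc (thin K B) a M
  have h2 := count_add_ncard_inter_Icc B a M
  rw [count_thin hK, count_thin hK] at h1
  have hK' : (0 : ℝ) < K := by exact_mod_cast hK
  have e1 := Nat.mul_div_le (Nat.count (· ∈ B) (a + 1) + (K - 1)) K
  have e2 := Nat.lt_mul_div_succ (Nat.count (· ∈ B) (a + M + 1) + (K - 1)) hK
  rw [← h1] at e2
  rw [div_mul_eq_mul_div, one_mul, div_le_iff₀ hK']
  have : (B ∩ Set.Icc (a + 1) (a + M)).ncard ≤
      K * ((thin K B ∩ Set.Icc (a + 1) (a + M)).ncard + 1) := by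
    rw [mul_add, mul_add] at e2
    rw [mul_add]
    lia
  rw [mul_comm]
  exact_mod_cast this

/-! ### Separating sets within a family -/

/-- Each point of T below M + g contributes an interval of at most 2g + 1 points. The point 0 is
excluded because the counts start at 1. -/
lemma ncard_neighbourhood_le {T : Set ℕ} {g R M : ℕ}
    (hT : (T ∩ Set.Icc 1 (M + g)).ncard ≤ R) (h0 : 0 ∉ T) :
    ({n | ∃ m ∈ T, m ≤ n + g ∧ n ≤ m + g} ∩ Set.Icc 1 M).ncard ≤ R * (2 * g + 1) := by
  have hfin : (T ∩ Set.Icc 1 (M + g)).Finite := (Set.finite_Icc _ _).inter_of_right _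
  have hsub : {n | ∃ m ∈ T, m ≤ n + g ∧ n ≤ m + g} ∩ Set.Icc 1 M ⊆
      ↑(hfin.toFinset.biUnion fun m => Finset.Icc (m - g) (m + g)) := by
    rintro n ⟨⟨m, hm, h1, h2⟩, h3, h4⟩
    simp only [Finset.coe_biUnion, Set.mem_iUnion, Finset.coe_Icc, Set.mem_Icc,
      Set.Finite.coe_toFinset, exists_prop]
    have : m ≠ 0 := fun h => h0 (h ▸ hm)
    exact ⟨m, ⟨hm, by omega, by omega⟩, by omega, by omega⟩
  refine (Set.ncard_le_ncard hsub (Finset.finite_toSet _)).trans ?_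
  rw [Set.ncard_coe_finset]
  refine (Finset.card_biUnion_le_card_mul _ _ (2 * g + 1) fun m _ => ?_).trans ?_
  · rw [Nat.card_Icc]; omega
  · refine Nat.mul_le_mul_right _ ?_
    rwa [← Set.ncard_eq_toFinset_card _ hfin]

/-- Thinned and pairwise separated subsets of given sets, whose counting functions on initial
intervals remain comparable to those of the given sets. -/
lemma exists_separated_of_initial (B : ℕ → Set ℕ) (G : ℕ → ℕ) (hG : Monotone G)
    (δ : ℕ → ℝ) (hδ : ∀ l, 0 < δ l) :
    ∃ E : ℕ → Set ℕ, (∀ l, E l ⊆ B l) ∧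
      (∀ l k, ∀ m ∈ E l, ∀ n ∈ E k, m < n → m + max (G l) (G k) ≤ n) ∧
      (∀ l k, l ≠ k → Disjoint (E l) (E k)) ∧
      ∀ l, ∃ c : ℝ, 0 < c ∧ ∃ q : ℕ, ∀ M ≥ q, δ l * M ≤ (B l ∩ Set.Icc 1 M).ncard →
        c * M ≤ (E l ∩ Set.Icc 1 M).ncard := by
  choose D hD using fun l => exists_nat_gt (1 / δ l)
  have hD0 : ∀ l, 0 < D l := fun l => by
    have : (0 : ℝ) < D l := (one_div_pos.2 (hδ l)).trans (hD l)
    exact_mod_cast this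
  -- Level k keeps every K_k-th element. The factors of c_k pay for the size 2 G_k + 1 of
  -- neighbourhoods, the reciprocal densities D_l of all lower levels, and summation over k; 16 is
  -- numerical slack.
  set c : ℕ → ℕ := fun k => 16 * 2 ^ k * (2 * G k + 1) * ∏ i ∈ Finset.range (k + 1), D i with hc
  set K : ℕ → ℕ := fun k => ∏ i ∈ Finset.range (k + 1), c i with hK
  have hprod : ∀ k, 0 < ∏ i ∈ Finset.range (k + 1), D i :=
    fun k => Finset.prod_pos fun i _ => hD0 i
  have hc0 : ∀ k, 0 < c k := fun k => Nat.mul_pos (by positivity) (hprod k)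
  have hK0 : ∀ k, 0 < K k := fun k => Finset.prod_pos fun i _ => hc0 i
  have hcK : ∀ k, c k ≤ K k := fun k =>
    Nat.le_of_dvd (hK0 k) (Finset.dvd_prod_of_mem c (Finset.self_mem_range_succ k))
  have hKK : ∀ l k, l < k → 16 * 2 ^ k * (2 * G k + 1) * D l * K l ≤ K k := by
    intro l k hlk
    obtain ⟨k, rfl⟩ : ∃ k', k = k' + 1 := ⟨k - 1, by omega⟩
    have h1 : K (k + 1) = K k * c (k + 1) := Finset.prod_range_succ c (k + 1)
    have h2 : K l ≤ K k := Finset.prod_le_prod_of_subset_of_one_le'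
      (Finset.range_mono (by omega)) fun i _ _ => hc0 i
    have h3 : D l ≤ ∏ i ∈ Finset.range (k + 1 + 1), D i :=
      Nat.le_of_dvd (hprod _) (Finset.dvd_prod_of_mem D (Finset.mem_range.2 (by omega)))
    rw [h1, mul_comm (K k)]
    exact Nat.mul_le_mul (Nat.mul_le_mul_left _ h3) h2
  have hGK : ∀ k, G k ≤ K k := fun k => by
    refine le_trans ?_ (hcK k)
    have h1 : 1 ≤ 16 * 2 ^ k := Nat.one_le_iff_ne_zero.2 (by positivity)
    calc G k ≤ 1 * (2 * G k + 1) * 1 := by omega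
      _ ≤ 16 * 2 ^ k * (2 * G k + 1) * ∏ i ∈ Finset.range (k + 1), D i :=
        Nat.mul_le_mul (Nat.mul_le_mul_right _ h1) (hprod k)
  have hkK : ∀ k, k < K k := fun k => by
    refine lt_of_lt_of_le Nat.lt_two_pow_self (le_trans ?_ (hcK k))
    calc 2 ^ k = 1 * 2 ^ k * 1 * 1 := by ring
      _ ≤ 16 * 2 ^ k * (2 * G k + 1) * ∏ i ∈ Finset.range (k + 1), D i :=
        Nat.mul_le_mul (Nat.mul_le_mul (Nat.mul_le_mul_right _ (by omega)) (by omega)) (hprod k)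
  -- Dropping the first 2 K_k integers pushes V_k beyond K_k, so V_k is counted only on intervals
  -- [1, M] with M ≥ K_k, where the rounding error 1 in `ncard_thin_le` is harmless.
  set T : ℕ → Set ℕ := fun k => thin (K k) (B k) \ Set.Iio (2 * K k) with hT
  set V : ℕ → Set ℕ := fun k => {n | ∃ m ∈ T k, m ≤ n + G k ∧ n ≤ m + G k} with hV
  have hfin : ∀ (S : Set ℕ) (a b : ℕ), (S ∩ Set.Icc a b).Finite :=
    fun S a b => (Set.finite_Icc _ _).inter_of_right _
  have hVle : ∀ l k M, l < k →
      ((V k ∩ Set.Icc 1 M).ncard : ℝ) ≤ 1 / 4 * (M / (D l * K l)) * (1 / 2) ^ k := by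
    intro l k M hlk
    have hKk : (0 : ℝ) < K k := by exact_mod_cast hK0 k
    have hden : (0 : ℝ) < D l * K l := by exact_mod_cast Nat.mul_pos (hD0 l) (hK0 l)
    rcases lt_or_ge M (K k) with hM | hM
    · have : V k ∩ Set.Icc 1 M = ∅ := by
        refine Set.eq_empty_of_forall_notMem ?_
        rintro n ⟨⟨m, hm, h1, h2⟩, h3, h4⟩
        have h5 : 2 * K k ≤ m := not_lt.1 hm.2
        have h6 := hGK k
        have h7 : n ≤ M := h4
        omega
      rw [this]
      simp only [Set.ncard_empty, Nat.cast_zero]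
      positivity
    · have h1 : ((T k ∩ Set.Icc 1 (M + G k)).ncard : ℝ) ≤ 3 * M / K k := by
        have h2 : ((T k ∩ Set.Icc 1 (M + G k)).ncard : ℝ) ≤
            (thin (K k) (B k) ∩ Set.Icc (0 + 1) (0 + (M + G k))).ncard := by
          rw [zero_add, zero_add]
          exact_mod_cast Set.ncard_le_ncard
            (Set.inter_subset_inter_left _ Set.sdiff_subset) (hfin _ _ _)
        refine h2.trans ((ncard_thin_le (hK0 k) _ _ _).trans ?_)
        rw [div_add_one hKk.ne']
        refine div_le_div_of_nonneg_right ?_ hKk.le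
        have h3 : (G k : ℝ) ≤ K k := by exact_mod_cast hGK k
        have h4 : (K k : ℝ) ≤ M := by exact_mod_cast hM
        push_cast
        linarith
      have h2 := ncard_neighbourhood_le (T := T k) (g := G k) (M := M) le_rfl (fun h => by
        have h5 : 2 * K k ≤ 0 := not_lt.1 h.2
        have := hK0 k
        omega)
      have h3 : ((V k ∩ Set.Icc 1 M).ncard : ℝ) ≤
          (T k ∩ Set.Icc 1 (M + G k)).ncard * (2 * G k + 1) := by exact_mod_cast h2
      have h4 : (16 * 2 ^ k * (2 * G k + 1) * D l * K l : ℝ) ≤ K k := by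
        exact_mod_cast hKK l k hlk
      calc ((V k ∩ Set.Icc 1 M).ncard : ℝ) ≤ 3 * M / K k * (2 * G k + 1) :=
            h3.trans (mul_le_mul_of_nonneg_right h1 (by positivity))
        _ ≤ 3 * M / (16 * 2 ^ k * (2 * G k + 1) * D l * K l) * (2 * G k + 1) := by
            refine mul_le_mul_of_nonneg_right ?_ (by positivity)
            exact div_le_div_of_nonneg_left (by positivity) (by
              have : (0 : ℝ) < 16 * 2 ^ k * (2 * G k + 1) := by positivity
              rw [mul_assoc _ (D l : ℝ)]; positivity) h4
        _ = 3 / 16 * (M / (D l * K l)) * (1 / 2) ^ k := by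
            have h5 : (2 * G k + 1 : ℝ) ≠ 0 := by positivity
            have h6 : (D l : ℝ) ≠ 0 := by exact_mod_cast (hD0 l).ne'
            have h7 : (K l : ℝ) ≠ 0 := by exact_mod_cast (hK0 l).ne'
            rw [one_div_pow]
            field_simp
        _ ≤ 1 / 4 * (M / (D l * K l)) * (1 / 2) ^ k := by
            refine mul_le_mul_of_nonneg_right (mul_le_mul_of_nonneg_right ?_ ?_) ?_
            · norm_num
            · positivity
            · positivity
  have hUle : ∀ l M, (((⋃ k ∈ Set.Ioi l, V k) ∩ Set.Icc 1 M).ncard : ℝ) ≤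
      1 / 2 * (M / (D l * K l)) := by
    intro l M
    have hsub : (⋃ k ∈ Set.Ioi l, V k) ∩ Set.Icc 1 M ⊆
        -- Points of V_k exceed K_k - 1 ≥ k - 1, so only finitely many levels meet [1, M].
        ⋃ k ∈ Finset.Ioc l M, (V k ∩ Set.Icc 1 M) := by
      rintro n ⟨hn, h1, h2⟩
      simp only [Set.mem_iUnion] at hn ⊢
      obtain ⟨k, hk, m, hm, h3, h4⟩ := hn
      refine ⟨k, Finset.mem_Ioc.2 ⟨hk, ?_⟩, ⟨m, hm, h3, h4⟩, h1, h2⟩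
      have h5 : 2 * K k ≤ m := not_lt.1 hm.2
      have h6 := hGK k
      have h7 := hkK k
      omega
    have h1 : ((⋃ k ∈ Set.Ioi l, V k) ∩ Set.Icc 1 M).ncard ≤
        ∑ k ∈ Finset.Ioc l M, (V k ∩ Set.Icc 1 M).ncard :=
      (Set.ncard_le_ncard hsub (Set.Finite.biUnion (Finset.finite_toSet _)
        fun k _ => hfin _ _ _)).trans (Finset.set_ncard_biUnion_le _ _)
    have hden : (0 : ℝ) < D l * K l := by exact_mod_cast Nat.mul_pos (hD0 l) (hK0 l)
    calc (((⋃ k ∈ Set.Ioi l, V k) ∩ Set.Icc 1 M).ncard : ℝ)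
        ≤ ∑ k ∈ Finset.Ioc l M, ((V k ∩ Set.Icc 1 M).ncard : ℝ) := by exact_mod_cast h1
      _ ≤ ∑ k ∈ Finset.Ioc l M, 1 / 4 * (M / (D l * K l)) * (1 / 2 : ℝ) ^ k :=
          Finset.sum_le_sum fun k hk => hVle l k M (Finset.mem_Ioc.1 hk).1
      _ = 1 / 4 * (M / (D l * K l)) * ∑ k ∈ Finset.Ioc l M, (1 / 2 : ℝ) ^ k := by
          rw [Finset.mul_sum]
      _ ≤ 1 / 4 * (M / (D l * K l)) * 2 := by
          refine mul_le_mul_of_nonneg_left ?_ (by positivity)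
          refine le_of_le_of_eq ?_ tsum_geometric_two
          exact summable_geometric_two.sum_le_tsum _ fun i _ => by positivity
      _ = 1 / 2 * (M / (D l * K l)) := by ring
  -- In a conflict between two levels the higher, sparser one wins, since it removes only a small
  -- proportion of the lower one.
  refine ⟨fun l => T l \ ⋃ k ∈ Set.Ioi l, V k, fun l => Set.sdiff_subset.trans
    (Set.sdiff_subset.trans (thin_subset _ _)), ?_, ?_, ?_⟩
  · intro l k m hm n hn hlt
    rcases lt_trichotomy l k with h | rfl | h
    · rw [max_eq_right (hG h.le)]
      by_contra hcon
      refine hm.2 (Set.mem_biUnion h ⟨n, hn.1, by omega, by omega⟩)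
    · rw [max_self]
      exact (Nat.add_le_add_left (hGK l) m).trans (add_le_of_mem_thin hm.1.1 hn.1.1 hlt)
    · rw [max_eq_left (hG h.le)]
      by_contra hcon
      refine hn.2 (Set.mem_biUnion h ⟨m, hm.1, by omega, by omega⟩)
  · have key : ∀ l k, l < k → Disjoint (T l \ ⋃ k ∈ Set.Ioi l, V k)
        (T k \ ⋃ i ∈ Set.Ioi k, V i) := by
      intro l k h
      refine Set.disjoint_left.2 fun n hn hn' => ?_
      exact hn.2 (Set.mem_biUnion h ⟨n, hn'.1, by omega, by omega⟩)
    intro l k h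
    rcases lt_or_gt_of_ne h with h | h
    · exact key l k h
    · exact (key k l h).symm
  · intro l
    have hden : (0 : ℝ) < D l * K l := by exact_mod_cast Nat.mul_pos (hD0 l) (hK0 l)
    have hDl : (0 : ℝ) < D l := by exact_mod_cast hD0 l
    have hKl : (0 : ℝ) < K l := by exact_mod_cast hK0 l
    obtain ⟨q, hq⟩ := exists_nat_ge ((1 + 2 * K l : ℝ) / (1 / 4 * (1 / (D l * K l))))
    -- Thinning leaves about M / (D_l K_l) elements; the neighbourhoods remove at most half of that,
    -- and for M ≥ q the bounded loss 1 + 2 K_l takes at most another quarter.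
    refine ⟨1 / 4 * (1 / (D l * K l)), by positivity, q, fun M hM hle => ?_⟩
    rw [div_le_iff₀ (by positivity)] at hq
    have h1 := le_ncard_thin (hK0 l) (B l) 0 M
    rw [zero_add, zero_add] at h1
    have hsub : thin (K l) (B l) ∩ Set.Icc 1 M ⊆
        (((T l \ ⋃ k ∈ Set.Ioi l, V k) ∩ Set.Icc 1 M) ∪ Set.Iio (2 * K l)) ∪
          ((⋃ k ∈ Set.Ioi l, V k) ∩ Set.Icc 1 M) := by
      rintro n ⟨hn, hn'⟩
      by_cases h2 : n ∈ ⋃ k ∈ Set.Ioi l, V k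
      · exact Or.inr ⟨h2, hn'⟩
      · refine Or.inl ?_
        by_cases h3 : n < 2 * K l
        · exact Or.inr h3
        · exact Or.inl ⟨⟨⟨hn, h3⟩, h2⟩, hn'⟩
    have h2 := (Set.ncard_le_ncard hsub (((hfin _ _ _).union (Set.finite_Iio _)).union
      (hfin _ _ _))).trans ((Set.ncard_union_le _ _).trans
        (Nat.add_le_add_right (Set.ncard_union_le _ _) _))
    have h3 : (Set.Iio (2 * K l)).ncard = 2 * K l := by
      rw [← Finset.coe_Iio, Set.ncard_coe_finset, Nat.card_Iio]
    rw [h3] at h2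
    have h4 : ((thin (K l) (B l) ∩ Set.Icc 1 M).ncard : ℝ) ≤
        ((T l \ ⋃ k ∈ Set.Ioi l, V k) ∩ Set.Icc 1 M).ncard + 2 * K l +
          ((⋃ k ∈ Set.Ioi l, V k) ∩ Set.Icc 1 M).ncard := by exact_mod_cast h2
    have h5 := hUle l M
    have h6 : (M : ℝ) / (D l * K l) ≤ 1 / K l * (B l ∩ Set.Icc 1 M).ncard := by
      have h7 : 1 / (D l : ℝ) ≤ δ l := by
        rw [one_div_le hDl (hδ l)]
        exact (hD l).le
      calc (M : ℝ) / (D l * K l) = 1 / K l * (1 / D l * M) := by field_simp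
        _ ≤ 1 / K l * (δ l * M) := by gcongr
        _ ≤ _ := by gcongr
    have h8 : (q : ℝ) * (1 / 4 * (1 / (D l * K l))) ≤ M * (1 / 4 * (1 / (D l * K l))) :=
      mul_le_mul_of_nonneg_right (by exact_mod_cast hM) (by positivity)
    have h9 : (M : ℝ) / (D l * K l) = 4 * (M * (1 / 4 * (1 / (D l * K l)))) := by field_simp
    rw [h9] at h5 h6
    linarith

lemma exists_separated_familyUBD (B : ℕ → Set ℕ) (hB : ∀ l, B l ∈ familyUBD) (G : ℕ → ℕ) :
    ∃ E : ℕ → Set ℕ, (∀ l, E l ⊆ B l) ∧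
      (∀ l k, ∀ m ∈ E l, ∀ n ∈ E k, m < n → m + max (G l) (G k) ≤ n) ∧
      (∀ l k, l ≠ k → Disjoint (E l) (E k)) ∧ ∀ l, E l ∈ familyUBD := by
  set T : ℕ → Set ℕ := fun l => thin (G l + 1) (B l) with hT
  have hTmem : ∀ l, T l ∈ familyUBD := fun l =>
    mem_family_of_proportion (Or.inl rfl) (hB l) (c := 1 / ((G l + 1 : ℕ) : ℝ)) (C := 1)
      (by positivity) (le_ncard_thin (Nat.succ_pos _) (B l))
  choose δ hδ hw using fun l => mem_familyUBD_iff.1 (hTmem l)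
  choose M hM a ha hle using hw
  -- the `i`-th window is reserved for the level `(Nat.unpair i).1`
  set S : ℕ → ℕ := fun i => ∑ j ∈ Finset.range (i + 1), G (Nat.unpair j).1 with hS
  have hSG : ∀ i j, i ≤ j → G (Nat.unpair i).1 ≤ S j := fun i j hij =>
    Finset.single_le_sum (f := fun j => G (Nat.unpair j).1) (fun _ _ => Nat.zero_le _)
      (Finset.mem_range.2 (by omega))
  -- All windows before the i-th end below e_i, and the i-th starts past q_i = e_i + i + S_{i+1}.
  -- Hence distinct windows are separated by sums of G dominating the gaps of both levels, and the
  -- summand i makes window lengths unbounded on each level.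
  let e : ℕ → ℕ := fun i => Nat.rec 0 (fun i e =>
    a (Nat.unpair i).1 (e + i + S (i + 1)) + M (Nat.unpair i).1 (e + i + S (i + 1)) +
      S (i + 1)) i
  set q : ℕ → ℕ := fun i => e i + i + S (i + 1) with hq
  have he : ∀ i, e (i + 1) = a (Nat.unpair i).1 (q i) + M (Nat.unpair i).1 (q i) + S (i + 1) :=
    fun i => rfl
  have hemono : Monotone e := monotone_nat_of_le_succ fun i => by
    rw [he]
    have := ha (Nat.unpair i).1 (q i)
    simp only [hq] at this ⊢
    omega
  set I : ℕ → Set ℕ := fun i => Set.Icc (a (Nat.unpair i).1 (q i) + 1)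
    (a (Nat.unpair i).1 (q i) + M (Nat.unpair i).1 (q i)) with hI
  have hsep : ∀ i j, i < j → ∀ m ∈ I i, ∀ n ∈ I j, m + S j ≤ n ∧ m < n := by
    intro i j hij m hm n hn
    have h1 : e (i + 1) ≤ e j := hemono hij
    have h2 := he i
    have h3 := ha (Nat.unpair j).1 (q j)
    have h4 : S j ≤ S (j + 1) := Finset.sum_le_sum_of_subset (Finset.range_mono (by omega))
    have h5 := hm.2
    have h6 := hn.1
    simp only [hq] at *
    omega
  refine ⟨fun l => {n | n ∈ T l ∧ ∃ i, (Nat.unpair i).1 = l ∧ n ∈ I i},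
    fun l n hn => thin_subset _ _ hn.1, ?_, ?_, ?_⟩
  · rintro l k m ⟨hm, i, rfl, hmi⟩ n ⟨hn, j, rfl, hnj⟩ hlt
    rcases lt_trichotomy i j with h | rfl | h
    · have h1 := hsep i j h m hmi n hnj
      have h2 := hSG i j h.le
      have h3 := hSG j j le_rfl
      have := max_le h2 h3
      omega
    · rw [max_self]
      have := add_le_of_mem_thin hm hn hlt
      omega
    · have h1 := hsep j i h n hnj m hmi
      omega
  · intro l k hlk
    refine Set.disjoint_left.2 ?_
    rintro n ⟨hm, i, rfl, hmi⟩ ⟨hn, j, rfl, hnj⟩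
    rcases lt_trichotomy i j with h | rfl | h
    · exact lt_irrefl _ (hsep i j h n hmi n hnj).2
    · exact hlk rfl
    · exact lt_irrefl _ (hsep j i h n hnj n hmi).2
  · intro l
    refine mem_familyUBD_iff.2 ⟨δ l, hδ l, fun m => ?_⟩
    -- Each level owns infinitely many windows; this one has index at least m.
    set i := Nat.pair l m with hi
    have hil : (Nat.unpair i).1 = l := by simp [hi]
    have hmi : m ≤ i := Nat.right_le_pair l m
    have hmq : m ≤ q i := by simp only [hq]; omega
    refine ⟨M l (q i), hmq.trans (hM _ _), a l (q i), hmq.trans (ha _ _),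
      (hle l (q i)).trans ?_⟩
    have hsub : T l ∩ Set.Icc (a l (q i) + 1) (a l (q i) + M l (q i)) ⊆
        {n | n ∈ T l ∧ ∃ i, (Nat.unpair i).1 = l ∧ n ∈ I i} ∩
          Set.Icc (a l (q i) + 1) (a l (q i) + M l (q i)) := by
      rintro n ⟨h1, h2⟩
      refine ⟨⟨h1, i, hil, ?_⟩, h2⟩
      simp only [hI, hil]
      exact h2
    exact_mod_cast Set.ncard_le_ncard hsub ((Set.finite_Icc _ _).inter_of_right _)

/-- Sets in one of the three families have subsets in the same family that are pairwise disjoint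
and separated by prescribed gaps. -/
lemma exists_separated {𝒜 : Set (Set ℕ)}
    (h𝒜 : 𝒜 = familyUBD ∨ 𝒜 = familyUD ∨ 𝒜 = familyLD) (B : ℕ → Set ℕ) (hB : ∀ l, B l ∈ 𝒜)
    (G : ℕ → ℕ) (hG : Monotone G) :
    ∃ E : ℕ → Set ℕ, (∀ l, E l ∈ 𝒜) ∧ (∀ l, E l ⊆ B l) ∧
      (∀ l k, ∀ m ∈ E l, ∀ n ∈ E k, m < n → m + max (G l) (G k) ≤ n) ∧
      (∀ l k, l ≠ k → Disjoint (E l) (E k)) := by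
  rcases h𝒜 with rfl | rfl | rfl
  · obtain ⟨E, h1, h2, h3, h4⟩ := exists_separated_familyUBD B hB G
    exact ⟨E, h4, h1, h2, h3⟩
  · choose δ hδ hw using fun l => mem_familyUD_iff.1 (hB l)
    obtain ⟨E, h1, h2, h3, h4⟩ := exists_separated_of_initial B G hG δ hδ
    refine ⟨E, fun l => ?_, h1, h2, h3⟩
    obtain ⟨c, hc, q, hq⟩ := h4 l
    exact mem_familyUD_iff.2 ⟨c, hc, ((hw l).and_eventually (eventually_ge_atTop q)).mono
      fun M hM => hq M hM.2 hM.1⟩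
  · choose δ hδ hw using fun l => mem_familyLD_iff.1 (hB l)
    obtain ⟨E, h1, h2, h3, h4⟩ := exists_separated_of_initial B G hG δ hδ
    refine ⟨E, fun l => ?_, h1, h2, h3⟩
    obtain ⟨c, hc, q, hq⟩ := h4 l
    exact mem_familyLD_iff.2 ⟨c, hc, ((hw l).and (eventually_ge_atTop q)).mono
      fun M hM => hq M hM.2 hM.1⟩

/-! ### Return times of sets of positive upper Banach density -/

lemma ncard_inter_Icc_eq_sum (A : Set ℕ) (a M : ℕ) :
    ((A ∩ Set.Icc (a + 1) (a + M)).ncard : ℝ) =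
      ∑ i ∈ Finset.range M, A.indicator 1 (a + 1 + i) := by
  classical
  have h1 := count_add_ncard_inter_Icc A a M
  rw [show a + M + 1 = a + 1 + M by ring, Nat.count_add _ (a + 1),
    Nat.count_eq_card_filter_range _ M] at h1
  rw [Nat.add_left_cancel h1, Finset.card_filter, Nat.cast_sum]
  refine Finset.sum_congr rfl fun i _ => ?_
  simp [Set.indicator_apply]

/-- A shift-invariant finitely additive mean that is obtained as a limit of averages over windows,
and gives positive mass to a given set of positive upper Banach density. -/
lemma exists_window_mean {A : Set ℕ} (hA : A ∈ familyUBD) :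
    ∃ (μ : Set ℕ → ℝ) (a M : ℕ → ℕ), 0 < μ A ∧ (∀ i, 0 < M i) ∧
      (∀ (E : Set ℕ) (g : ℕ), μ {n | n + g ∈ E} = μ E) ∧
      ∀ E : Set ℕ, Tendsto (fun i => (∑ k ∈ Finset.range (M i),
        E.indicator (1 : ℕ → ℝ) (a i + 1 + k)) / M i) (hyperfilter ℕ) (𝓝 (μ E)) := by
  obtain ⟨δ, hδ, hw⟩ := mem_familyUBD_iff.1 hA
  choose M hM a _ hle using fun i => hw (i + 1)
  have hM0 : ∀ i, (0 : ℝ) < M i := fun i => by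
    have := hM i
    exact_mod_cast (show 0 < M i by omega)
  have hMt : Tendsto (fun i => (M i : ℝ)) (hyperfilter ℕ) atTop := by
    refine Tendsto.mono_left ?_ Nat.hyperfilter_le_atTop
    refine tendsto_natCast_atTop_atTop.comp (tendsto_atTop_mono (fun i => ?_) tendsto_id)
    have := hM i
    simp only [id]
    omega
  have hlim : ∀ E : Set ℕ, ∃ x : ℝ, Tendsto (fun i => (∑ k ∈ Finset.range (M i),
      E.indicator (1 : ℕ → ℝ) (a i + 1 + k)) / M i) (hyperfilter ℕ) (𝓝 x) := by
    intro E
    have hmem : ∀ i, (∑ k ∈ Finset.range (M i), E.indicator (1 : ℕ → ℝ) (a i + 1 + k)) / M i ∈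
        Set.Icc (0 : ℝ) 1 := fun i => by
      rw [← ncard_inter_Icc_eq_sum]
      exact ⟨by positivity, ncard_inter_div_le_one _ _ _⟩
    -- Limits along a non-principal ultrafilter exist for all sets simultaneously, by compactness of
    -- [0, 1].
    obtain ⟨x, _, hx⟩ := (isCompact_Icc (a := (0 : ℝ)) (b := 1)).ultrafilter_le_nhds
      ((hyperfilter ℕ).map _) (by
        rw [le_principal_iff]
        exact Filter.mem_map.2 (Filter.univ_mem' hmem))
    exact ⟨x, hx⟩
  choose μ hμ using hlim
  refine ⟨μ, a, M, ?_, fun i => by exact_mod_cast hM0 i, ?_, hμ⟩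
  · refine hδ.trans_le (ge_of_tendsto' (hμ A) fun i => ?_)
    rw [le_div_iff₀ (hM0 i), ← ncard_inter_Icc_eq_sum]
    exact hle i
  · have h1 : ∀ E : Set ℕ, μ {n | n + 1 ∈ E} = μ E := by
      intro E
      have h2 := (hμ {n | n + 1 ∈ E}).sub (hμ E)
      have h3 : Tendsto (fun i => (∑ k ∈ Finset.range (M i),
          {n | n + 1 ∈ E}.indicator (1 : ℕ → ℝ) (a i + 1 + k)) / M i -
          (∑ k ∈ Finset.range (M i), E.indicator (1 : ℕ → ℝ) (a i + 1 + k)) / M i)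
          (hyperfilter ℕ) (𝓝 0) := by
        refine squeeze_zero_norm (a := fun i => 2 / (M i : ℝ)) (fun i => ?_)
          (tendsto_const_nhds.div_atTop hMt)
        -- The difference telescopes to two boundary terms, negligible against the window length.
        rw [← sub_div, ← Finset.sum_sub_distrib, Finset.sum_congr rfl (g := fun k =>
          E.indicator (1 : ℕ → ℝ) (a i + 1 + (k + 1)) - E.indicator (1 : ℕ → ℝ) (a i + 1 + k))
          (fun k _ => by rfl), Finset.sum_range_sub (fun k =>
          E.indicator (1 : ℕ → ℝ) (a i + 1 + k)), norm_div, Real.norm_natCast]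
        refine div_le_div_of_nonneg_right ((norm_sub_le _ _).trans ?_) (hM0 i).le
        have h4 : ∀ n, ‖E.indicator (1 : ℕ → ℝ) n‖ ≤ 1 := fun n =>
          (norm_indicator_le_norm_self _ _).trans (by simp)
        linarith [h4 (a i + 1 + M i), h4 (a i + 1 + 0)]
      exact sub_eq_zero.1 (tendsto_nhds_unique h2 h3)
    intro E g
    induction g with
    | zero => rfl
    | succ g ih =>
      rw [← ih, ← h1 {n | n + g ∈ E}]
      congr 1
      ext n
      simp [add_right_comm, add_assoc]

/-- For a set `A` of positive upper Banach density the times `h` for which the set `A ∩ (A - h)`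
is not too small are syndetic, for a suitable mean. -/
lemma exists_syndetic_returns {A : Set ℕ} {μ : Set ℕ → ℝ} {a M : ℕ → ℕ} (hA : 0 < μ A)
    (hM : ∀ i, 0 < M i) (hμ : ∀ (E : Set ℕ) (g : ℕ), μ {n | n + g ∈ E} = μ E)
    (hlim : ∀ E : Set ℕ, Tendsto (fun i => (∑ k ∈ Finset.range (M i),
        E.indicator (1 : ℕ → ℝ) (a i + 1 + k)) / M i) (hyperfilter ℕ) (𝓝 (μ E))) :
    ∃ δ > 0, ∃ G : ℕ, ∀ h ≥ 1, ∃ e ≤ G, δ ≤ μ (A ∩ {n | n + (h + e) ∈ A}) := by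
  -- Pointwise, if X is the number of g in S with n + g in A, this says X ≤ 1 + (X² - X), that is (X
  -- - 1)² ≥ 0.
  have hpair : ∀ S : Finset ℕ, ∑ g ∈ S, μ {n | n + g ∈ A} ≤
      1 + ∑ g ∈ S, ∑ g' ∈ S.erase g, μ ({n | n + g ∈ A} ∩ {n | n + g' ∈ A}) := by
    intro S
    refine le_of_tendsto_of_tendsto' (tendsto_finsetSum S fun g _ => hlim {n | n + g ∈ A})
      (tendsto_const_nhds.add (tendsto_finsetSum S fun g _ => tendsto_finsetSum (S.erase g)
        fun g' _ => hlim ({n | n + g ∈ A} ∩ {n | n + g' ∈ A}))) fun i => ?_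
    have hMi : (0 : ℝ) < M i := by exact_mod_cast hM i
    simp_rw [← Finset.sum_div]
    rw [← sub_nonneg, add_sub_assoc, ← sub_div, ← neg_le_iff_add_nonneg', ← neg_sub, neg_div,
      neg_le_neg_iff, div_le_one hMi, sub_le_iff_le_add]
    have hsw : ∑ g ∈ S, ∑ g' ∈ S.erase g, ∑ k ∈ Finset.range (M i),
        ({n | n + g ∈ A} ∩ {n | n + g' ∈ A}).indicator (1 : ℕ → ℝ) (a i + 1 + k) =
        ∑ k ∈ Finset.range (M i), ∑ g ∈ S, ∑ g' ∈ S.erase g,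
          ({n | n + g ∈ A} ∩ {n | n + g' ∈ A}).indicator (1 : ℕ → ℝ) (a i + 1 + k) := by
      rw [Finset.sum_comm (s := Finset.range (M i))]
      exact Finset.sum_congr rfl fun g _ => Finset.sum_comm
    rw [hsw, Finset.sum_comm]
    have hone : (M i : ℝ) = ∑ k ∈ Finset.range (M i), (1 : ℝ) := by simp
    rw [hone, ← Finset.sum_add_distrib]
    refine Finset.sum_le_sum fun k _ => ?_
    set n := a i + 1 + k
    set x : ℕ → ℝ := fun g => ({n | n + g ∈ A} : Set ℕ).indicator (1 : ℕ → ℝ) n with hx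
    have hmul : ∀ g g', ({n | n + g ∈ A} ∩ {n | n + g' ∈ A}).indicator (1 : ℕ → ℝ) n =
        x g * x g' := fun g g' => by
      rw [Set.inter_indicator_one]; rfl
    have hself : ∀ g, x g * x g = x g := fun g => by
      rw [← hmul, Set.inter_self]
    have hsum : ∑ g ∈ S, ∑ g' ∈ S.erase g,
        ({n | n + g ∈ A} ∩ {n | n + g' ∈ A}).indicator (1 : ℕ → ℝ) n =
        (∑ g ∈ S, x g) * (∑ g ∈ S, x g) - ∑ g ∈ S, x g := by
      rw [Finset.sum_mul_sum, ← Finset.sum_sub_distrib]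
      refine Finset.sum_congr rfl fun g hg => ?_
      rw [← Finset.add_sum_erase S _ hg, hself, add_sub_cancel_left]
      exact Finset.sum_congr rfl fun g' _ => hmul g g'
    rw [hsum]
    nlinarith [sq_nonneg (∑ g ∈ S, x g - 1)]
  have hshift : ∀ g g', g < g' → μ ({n | n + g ∈ A} ∩ {n | n + g' ∈ A}) =
      μ (A ∩ {n | n + (g' - g) ∈ A}) := by
    intro g g' h
    rw [← hμ (A ∩ {n | n + (g' - g) ∈ A}) g]
    congr 1
    ext n
    simp only [Set.mem_inter_iff, Set.mem_ofPred_eq]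
    rw [show n + g + (g' - g) = n + g' by omega]
  obtain ⟨r, hr⟩ := exists_nat_gt (2 / μ A)
  have hr0 : (0 : ℝ) < r := (div_pos two_pos hA).trans hr
  rw [div_lt_iff₀ hA] at hr
  refine ⟨1 / (r * r : ℝ), by positivity, ?_⟩
  by_contra! hcon
  -- Without syndetic returns, shifts with almost disjoint translates can be added greedily: a
  -- stretch of length max S + 1 without good returns starts at some h, and all differences between
  -- max S + h and elements of S fall into it. With r shifts, `hpair` would give r μ(A) ≤ 1 + 1,
  -- against the choice of r.
  have hS : ∀ k : ℕ, ∃ S : Finset ℕ, S.card = k ∧ ∀ g ∈ S, ∀ g' ∈ S, g < g' →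
      μ (A ∩ {n | n + (g' - g) ∈ A}) < 1 / (r * r : ℝ) := by
    intro k
    induction k with
    | zero => exact ⟨∅, rfl, by simp⟩
    | succ k ih =>
      obtain ⟨S, hc, hS⟩ := ih
      obtain ⟨h, h1, hh⟩ := hcon (S.sup id)
      have hle : ∀ g ∈ S, g ≤ S.sup id := fun g hg => Finset.le_sup (f := id) hg
      refine ⟨insert (S.sup id + h) S, ?_, ?_⟩
      · rw [Finset.card_insert_of_notMem (fun hm => by have := hle _ hm; omega), hc]
      · intro g hg g' hg' hlt
        rcases Finset.mem_insert.1 hg with rfl | hg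
        · rcases Finset.mem_insert.1 hg' with rfl | hg'
          · omega
          · have := hle _ hg'
            omega
        · rcases Finset.mem_insert.1 hg' with rfl | hg'
          · have h2 := hle _ hg
            have := hh (S.sup id - g) (by omega)
            rwa [show S.sup id + h - g = h + (S.sup id - g) by omega]
          · exact hS g hg g' hg' hlt
  obtain ⟨S, hc, hS⟩ := hS r
  have h1 := hpair S
  have h2 : ∑ g ∈ S, μ {n | n + g ∈ A} = r * μ A := by
    simp [hμ A, hc]
  have h3 : ∑ g ∈ S, ∑ g' ∈ S.erase g, μ ({n | n + g ∈ A} ∩ {n | n + g' ∈ A}) ≤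
      ∑ g ∈ S, ∑ g' ∈ S, 1 / (r * r : ℝ) := by
    refine Finset.sum_le_sum fun g hg => (Finset.sum_le_sum fun g' hg' => ?_).trans
      (Finset.sum_le_sum_of_subset_of_nonneg (Finset.erase_subset g S) fun _ _ _ => by positivity)
    obtain ⟨hne, hg'⟩ := Finset.mem_erase.1 hg'
    rcases lt_or_gt_of_ne hne with h | h
    · rw [Set.inter_comm, hshift _ _ h]
      exact (hS _ hg' _ hg h).le
    · rw [hshift _ _ h]
      exact (hS _ hg _ hg' h).le
  have h4 : ∑ g ∈ S, ∑ g' ∈ S, 1 / (r * r : ℝ) = 1 := by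
    simp only [Finset.sum_const, hc, nsmul_eq_mul]
    field_simp
  linarith

/-- If the sums of `α` over the positive return times of `A` are bounded, where `A` has positive
upper Banach density and `α` does not decrease too fast, then `α` is summable. -/
theorem summable_of_bounded_returns {A : Set ℕ} (hA : A ∈ familyUBD) {α : ℕ → ℝ}
    (h0 : ∀ n, 0 ≤ α n) {c : ℝ} (hc : 0 < c) (hα : ∀ n, c * α n ≤ α (n + 1)) {K : ℝ}
    (hK : ∀ n ∈ A, ∀ H : ℕ,
      ∑ h ∈ Finset.range H, {k | n + k ∈ A}.indicator α (h + 1) ≤ K) : Summable α := by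
  obtain ⟨μ, a, M, hA0, hM, hμ, hlim⟩ := exists_window_mean hA
  obtain ⟨δ, hδ, G, hG⟩ := exists_syndetic_returns hA0 hM hμ hlim
  set R : ℕ → ℝ := fun h => μ (A ∩ {n | n + h ∈ A}) with hR
  have hR0 : ∀ h, 0 ≤ R h := fun h => ge_of_tendsto' (hlim _) fun i =>
    div_nonneg (Finset.sum_nonneg fun k _ => Set.indicator_nonneg (fun _ _ => zero_le_one) _)
      (Nat.cast_nonneg _)
  -- The mean is applied to the bound on return sums; points outside A contribute 0, hence the
  -- maximum with 0.
  have hbound : ∀ H : ℕ, ∑ h ∈ Finset.range H, α (h + 1) * R (h + 1) ≤ max K 0 := by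
    intro H
    refine le_of_tendsto' (tendsto_finsetSum (Finset.range H) fun h _ =>
      (hlim (A ∩ {n | n + (h + 1) ∈ A})).const_mul (α (h + 1))) fun i => ?_
    have hMi : (0 : ℝ) < M i := by exact_mod_cast hM i
    simp_rw [mul_div_assoc']
    rw [← Finset.sum_div, div_le_iff₀ hMi]
    simp_rw [Finset.mul_sum]
    rw [Finset.sum_comm]
    have h1 : ∀ n, ∑ h ∈ Finset.range H,
        α (h + 1) * (A ∩ {n | n + (h + 1) ∈ A}).indicator (1 : ℕ → ℝ) n ≤ max K 0 := by
      intro n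
      by_cases hn : n ∈ A
      · refine le_trans (le_of_eq (Finset.sum_congr rfl fun h _ => ?_))
          ((hK n hn H).trans (le_max_left _ _))
        by_cases h2 : n + (h + 1) ∈ A <;> simp [hn, h2]
      · refine le_trans (le_of_eq (Finset.sum_eq_zero fun h _ => ?_)) (le_max_right _ _)
        simp [hn]
    refine (Finset.sum_le_sum fun k _ => h1 (a i + 1 + k)).trans ?_
    simp [mul_comm]
  set d : ℝ := min c 1 with hd
  have hd0 : 0 < d := lt_min hc one_pos
  have hpow : ∀ e n, d ^ e * α n ≤ α (n + e) := by
    intro e n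
    induction e with
    | zero => simp
    | succ e ih =>
      calc d ^ (e + 1) * α n = d * (d ^ e * α n) := by ring
        _ ≤ d * α (n + e) := mul_le_mul_of_nonneg_left ih hd0.le
        _ ≤ c * α (n + e) := mul_le_mul_of_nonneg_right (min_le_left _ _) (h0 _)
        _ ≤ α (n + (e + 1)) := hα _
  -- A good return occurs within G steps of h + 1, and α loses at most the factor d^G until then.
  have hterm : ∀ h, d ^ G * δ * α (h + 1) ≤
      ∑ e ∈ Finset.range (G + 1), α (e + h + 1) * R (e + h + 1) := by
    intro h
    obtain ⟨e, he, hle⟩ := hG (h + 1) (by omega)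
    have h1 : d ^ G ≤ d ^ e := pow_le_pow_of_le_one hd0.le (min_le_right _ _) he
    have h2 : h + 1 + e = e + h + 1 := by ring
    calc d ^ G * δ * α (h + 1) ≤ d ^ e * δ * α (h + 1) :=
          mul_le_mul_of_nonneg_right (mul_le_mul_of_nonneg_right h1 hδ.le) (h0 _)
      _ = (d ^ e * α (h + 1)) * δ := by ring
      _ ≤ α (h + 1 + e) * R (h + 1 + e) :=
          mul_le_mul (hpow e (h + 1)) hle hδ.le (h0 _)
      _ ≤ _ := by
          rw [h2]
          exact Finset.single_le_sum (f := fun e => α (e + h + 1) * R (e + h + 1))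
            (fun e _ => mul_nonneg (h0 _) (hR0 _)) (Finset.mem_range.2 (by omega))
  rw [← summable_nat_add_iff 1]
  refine summable_of_sum_range_le (c := (d ^ G * δ)⁻¹ * ((G + 1 : ℕ) * max K 0))
    (fun n => h0 _) fun n => ?_
  rw [le_inv_mul_iff₀ (by positivity), Finset.mul_sum]
  refine (Finset.sum_le_sum fun h _ => hterm h).trans ?_
  rw [Finset.sum_comm]
  refine (Finset.sum_le_card_nsmul _ _ (max K 0) fun e _ => ?_).trans (by simp)
  have h1 := hbound (e + n)
  rw [Finset.sum_range_add] at h1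
  have h2 : 0 ≤ ∑ h ∈ Finset.range e, α (h + 1) * R (h + 1) :=
    Finset.sum_nonneg fun h _ => mul_nonneg (h0 _) (hR0 _)
  linarith

/-! ### Iterates of strictly increasing maps -/

lemma lt_map_of_strictMono {f : ℕ+ → ℕ+} (hf : StrictMono f) (hf1 : 1 < f 1) (j : ℕ+) :
    j < f j := by
  induction j using PNat.recOn with
  | one => exact hf1
  | succ j ih => exact lt_of_le_of_lt (PNat.add_one_le_iff.2 ih) (hf (PNat.lt_add_right j 1))

lemma add_le_iterate {f : ℕ+ → ℕ+} (hf : StrictMono f) (hf1 : 1 < f 1) (n : ℕ) (j : ℕ+) :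
    (j : ℕ) + n ≤ (f^[n] j : ℕ+) := by
  induction n with
  | zero => simp
  | succ n ih =>
    rw [Function.iterate_succ_apply']
    have : ((f^[n] j : ℕ+) : ℕ) < (f (f^[n] j) : ℕ+) := lt_map_of_strictMono hf hf1 _
    omega

lemma iterate_left_strictMono {f : ℕ+ → ℕ+} (hf : StrictMono f) (hf1 : 1 < f 1) (j : ℕ+) :
    StrictMono fun n => f^[n] j :=
  strictMono_nat_of_lt_succ fun n => by
    rw [Function.iterate_succ_apply']
    exact lt_map_of_strictMono hf hf1 _

lemma iterInv_iterate {f : ℕ+ → ℕ+} (hf : StrictMono f) (n : ℕ) (j : ℕ+) :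
    iterInv f n (f^[n] j) = j :=
  Function.leftInverse_invFun (hf.iterate n).injective j

/-! ### Weight products -/

section Weights

variable {𝕜 : Type*} [RCLike 𝕜]

lemma weightProd_eq (f : ℕ+ → ℕ+) (w : ℕ+ → 𝕜) (j : ℕ+) (n : ℕ) :
    weightProd f w j n = ∏ m ∈ Finset.range n, w (f^[m + 1] j) := by
  rw [weightProd, Finset.range_eq_Ico, Finset.prod_Ico_add' (fun m => w (f^[m] j)) 0 n 1]
  rfl

lemma weightProd_zero (f : ℕ+ → ℕ+) (w : ℕ+ → 𝕜) (j : ℕ+) : weightProd f w j 0 = 1 := by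
  simp [weightProd_eq]

lemma weightProd_succ (f : ℕ+ → ℕ+) (w : ℕ+ → 𝕜) (j : ℕ+) (n : ℕ) :
    weightProd f w j (n + 1) = weightProd f w j n * w (f^[n + 1] j) := by
  simp [weightProd_eq, Finset.prod_range_succ]

lemma weightProd_add (f : ℕ+ → ℕ+) (w : ℕ+ → 𝕜) (j : ℕ+) (m n : ℕ) :
    weightProd f w j (m + n) = weightProd f w j m * weightProd f w (f^[m] j) n := by
  simp only [weightProd_eq, Finset.prod_range_add]
  congr 1
  refine Finset.prod_congr rfl fun i _ => ?_
  rw [← Function.iterate_add_apply]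
  congr 2
  ring

lemma pseudoShift_pow_apply (p : ℝ≥0∞) [Fact (1 ≤ p)] (f : ℕ+ → ℕ+) (hf : StrictMono f)
    (w : ℕ+ → 𝕜) (hw : BddAbove (Set.range fun j => ‖w (f j)‖))
    (x : lp (fun _ : ℕ+ => 𝕜) p) (n : ℕ) (j : ℕ+) :
    ((pseudoShift p f hf w hw ^ n) x) j = weightProd f w j n * x (f^[n] j) := by
  induction n generalizing x with
  | zero => simp [weightProd_zero]
  | succ n ih =>
    rw [pow_succ]
    change ((pseudoShift p f hf w hw ^ n) (pseudoShift p f hf w hw x)) j = _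
    rw [ih, pseudoShift_apply, weightProd_succ, Function.iterate_succ_apply', mul_assoc]

end Weights

lemma piMap_pow_apply {𝕜 : Type*} [NormedField 𝕜] {E : Type*} [NormedAddCommGroup E]
    [NormedSpace 𝕜 E] {N : ℕ} (T : Fin N → E →L[𝕜] E) (n : ℕ) (y : Fin N → E) (s : Fin N) :
    (ContinuousLinearMap.piMap T ^ n) y s = (T s ^ n) (y s) := by
  induction n generalizing y with
  | zero => rfl
  | succ n ih =>
    rw [pow_succ, pow_succ]
    exact ih _

/-! ### Norms in `ℓ^p` -/

section Lp

variable {𝕜 : Type*} [RCLike 𝕜] {p : ℝ≥0∞}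

lemma toReal_pos_of_one_le [h : Fact (1 ≤ p)] (hp : p ≠ ⊤) : 0 < p.toReal :=
  ENNReal.toReal_pos (zero_lt_one.trans_le h.out).ne' hp

lemma one_le_toReal [h : Fact (1 ≤ p)] (hp : p ≠ ⊤) : 1 ≤ p.toReal := by
  simpa using ENNReal.toReal_mono hp h.out

lemma tsum_enorm_rpow [Fact (1 ≤ p)] (hp : p ≠ ⊤) (z : lp (fun _ : ℕ+ => 𝕜) p) :
    ∑' j, ‖z j‖ₑ ^ p.toReal = ‖z‖ₑ ^ p.toReal := by
  have hp0 := toReal_pos_of_one_le hp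
  have h1 : ∀ a : ℝ, 0 ≤ a → ENNReal.ofReal a ^ p.toReal = ENNReal.ofReal (a ^ p.toReal) :=
    fun a ha => ENNReal.ofReal_rpow_of_nonneg ha hp0.le
  rw [← ofReal_norm z, h1 _ (norm_nonneg _), lp.norm_rpow_eq_tsum hp0,
    ENNReal.ofReal_tsum_of_nonneg (fun j => by positivity) ((lp.memℓp z).summable hp0)]
  refine tsum_congr fun j => ?_
  rw [← ofReal_norm (z j), h1 _ (norm_nonneg _)]

lemma memℓp_of_tsum_enorm_lt_top [Fact (1 ≤ p)] (hp : p ≠ ⊤) {z : ℕ+ → 𝕜}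
    (hz : ∑' j, ‖z j‖ₑ ^ p.toReal < ⊤) : Memℓp z p := by
  have hp0 := toReal_pos_of_one_le hp
  refine memℓp_gen ?_
  refine (ENNReal.summable_toReal hz.ne).congr fun j => ?_
  rw [← ENNReal.toReal_rpow, toReal_enorm]

end Lp

/-! ### Necessity -/

section Necessity

variable {𝕜 : Type*} [RCLike 𝕜]

/-- A sequence of finitely supported targets with large entries whose ratios are dense. -/
lemma exists_targets (𝕜 : Type*) [RCLike 𝕜] (N : ℕ) : ∃ y : ℕ+ → Fin N → ℕ+ → 𝕜,
    (∀ L s j, L < j → y L s j = 0) ∧ (∀ (L : ℕ+) s (j : ℕ+), j ≤ L → (L : ℝ) + 2 ≤ ‖y L s j‖) ∧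
    ∀ (l : ℕ+) (a : Fin N → ℕ+ → 𝕜), (∀ s, ∀ j ≤ l, a s j ≠ 0) → ∀ δ : ℝ, 0 < δ →
      ∀ L₀ : ℕ, ∃ L : ℕ+, L₀ ≤ L ∧ l ≤ L ∧
        (∀ s t i j, i ≤ l → j ≤ l → ‖y L s i / y L t j - a s i / a t j‖ ≤ δ) ∧
        (∀ s t i j, l < i → j ≤ l → ‖y L s i‖ ≤ δ * ‖y L t j‖) := by
  classical
  set d : ℕ → Fin N → ℕ+ → 𝕜 := TopologicalSpace.denseSeq _ with hd
  set b : ℕ → Fin N → ℕ+ → 𝕜 := fun n s j => if d n s j = 0 then 1 else d n s j with hb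
  have hb0 : ∀ n s j, b n s j ≠ 0 := fun n s j => by
    simp only [hb]
    split_ifs with h
    · exact one_ne_zero
    · exact h
  set c : ℕ+ → ℕ := fun L => (Nat.unpair L).1 with hc
  -- The index L encodes a member of the dense sequence, a cut-off l and a free parameter making L
  -- large. Up to l the pattern is copied; beyond l the entries 1/L are relatively small, as (4b)
  -- needs. Scaling by `r L` then makes all entries large without changing ratios.
  set v : ℕ+ → Fin N → ℕ+ → 𝕜 := fun L s j =>
    if (j : ℕ) ≤ (Nat.unpair (c L)).2 then b (Nat.unpair (c L)).1 s j else ((L : ℝ)⁻¹ : ℝ)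
    with hv
  have hv0 : ∀ L s j, v L s j ≠ 0 := fun L s j => by
    simp only [hv]
    split_ifs with h
    · exact hb0 _ _ _
    · simp
  set r : ℕ+ → ℝ := fun L => (L + 2) * ∑ q ∈ (Finset.univ : Finset (Fin N)) ×ˢ Finset.Iic L,
    ‖v L q.1 q.2‖⁻¹ with hr
  set y : ℕ+ → Fin N → ℕ+ → 𝕜 := fun L s j => if L < j then 0 else (r L : 𝕜) * v L s j with hy
  have hr0 : ∀ L, 0 ≤ r L := fun L => by
    simp only [hr]
    positivity
  have hlarge : ∀ (L : ℕ+) s (j : ℕ+), j ≤ L → (L : ℝ) + 2 ≤ ‖y L s j‖ := by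
    intro L s j hj
    have hpos : 0 < ‖v L s j‖ := norm_pos_iff.2 (hv0 L s j)
    have h1 : ‖v L s j‖⁻¹ ≤ ∑ q ∈ (Finset.univ : Finset (Fin N)) ×ˢ Finset.Iic L,
        ‖v L q.1 q.2‖⁻¹ :=
      Finset.single_le_sum (f := fun q : Fin N × ℕ+ => ‖v L q.1 q.2‖⁻¹)
        (fun _ _ => by positivity) (a := (s, j)) (by simp [hj])
    simp only [hy, not_lt.2 hj, if_false, norm_mul, RCLike.norm_ofReal, abs_of_nonneg (hr0 L)]
    calc (L : ℝ) + 2 = (L + 2) * ‖v L s j‖⁻¹ * ‖v L s j‖ := by field_simp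
      _ ≤ r L * ‖v L s j‖ := by
          refine mul_le_mul_of_nonneg_right ?_ hpos.le
          exact mul_le_mul_of_nonneg_left h1 (by positivity)
  refine ⟨y, fun L s j h => by simp [hy, h], hlarge, ?_⟩
  intro l a ha δ hδ L₀
  have hev : ∀ᶠ e in 𝓝 a, ∀ s t : Fin N, ∀ i ∈ Finset.Iic l, ∀ j ∈ Finset.Iic l,
      ‖e s i / e t j - a s i / a t j‖ < δ ∧ e s i ≠ 0 := by
    refine eventually_all.2 fun s => eventually_all.2 fun t =>
      (Finset.eventually_all _).2 fun i hi => (Finset.eventually_all _).2 fun j hj => ?_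
    rw [Finset.mem_Iic] at hi hj
    have h1 : ∀ s i, Tendsto (fun e : Fin N → ℕ+ → 𝕜 => e s i) (𝓝 a) (𝓝 (a s i)) := fun s i =>
      ((continuous_apply i).comp (continuous_apply s)).tendsto a
    have h2 := (h1 s i).div (h1 t j) (ha t j hj)
    refine Eventually.and ?_ ((h1 s i).eventually_ne (ha s i hi))
    have h3 := (tendsto_iff_norm_sub_tendsto_zero.1 h2).eventually (gt_mem_nhds hδ)
    exact h3
  obtain ⟨_, ⟨n, rfl⟩, hn⟩ := (TopologicalSpace.denseRange_denseSeq
    (Fin N → ℕ+ → 𝕜)).inter_nhds_nonempty hev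
  have hbd : ∀ s, ∀ i ≤ l, b n s i = d n s i := fun s i hi => by
    have := (hn s s i (Finset.mem_Iic.2 hi) i (Finset.mem_Iic.2 hi)).2
    simp only [hb]
    exact if_neg this
  obtain ⟨R, hR⟩ : ∃ R : ℝ, ∀ (t : Fin N) (j : Finset.Iic l), ‖b n t j‖⁻¹ ≤ R := by
    obtain ⟨R, hR⟩ := (Set.finite_range
      fun q : Fin N × Finset.Iic l => ‖b n q.1 q.2‖⁻¹).bddAbove
    exact ⟨R, fun t j => hR ⟨(t, j), rfl⟩⟩
  obtain ⟨m, hm⟩ := exists_nat_ge (R / δ)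
  set L : ℕ := Nat.pair (Nat.pair n l) (m + L₀ + l) with hL
  have hmL : m + L₀ + l ≤ L := Nat.right_le_pair _ _
  have hL0 : 0 < L := lt_of_lt_of_le (by have := l.pos; omega) hmL
  obtain ⟨P, hP⟩ : ∃ P : ℕ+, (P : ℕ) = L := ⟨⟨L, hL0⟩, rfl⟩
  have hc1 : c P = Nat.pair n l := by simp [hc, hP, hL]
  have hv1 : ∀ s, ∀ i ≤ l, v P s i = b n s i := fun s i hi => by
    have : (i : ℕ) ≤ l := hi
    simp [hv, hc1, this]
  have hv2 : ∀ s, ∀ i > l, v P s i = (((L : ℝ)⁻¹ : ℝ) : 𝕜) := fun s i hi => by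
    have : ¬ (i : ℕ) ≤ l := not_le.2 hi
    simp [hv, hc1, hP, this]
  have hlL : l ≤ P := by
    rw [← PNat.coe_le_coe]
    omega
  have hy1 : ∀ s, ∀ i ≤ l, y P s i = (r P : 𝕜) * b n s i := fun s i hi => by
    simp only [hy, not_lt.2 (hi.trans hlL), if_false, hv1 s i hi]
  refine ⟨P, by omega, hlL, ?_, ?_⟩
  · intro s t i j hi hj
    have hrne : (r P : 𝕜) ≠ 0 := by
      intro h
      have h2 := hlarge P s i (hi.trans hlL)
      rw [hy1 s i hi, h, zero_mul, norm_zero] at h2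
      have : (0 : ℝ) ≤ (P : ℕ) := by positivity
      linarith
    rw [hy1 s i hi, hy1 t j hj, mul_div_mul_left _ _ hrne, hbd s i hi, hbd t j hj]
    exact (hn s t i (Finset.mem_Iic.2 hi) j (Finset.mem_Iic.2 hj)).1.le
  · intro s t i j hi hj
    rcases lt_or_ge P i with h | h
    · have h1 : y P s i = 0 := if_pos h
      rw [h1, norm_zero]
      positivity
    · have hbj : 0 < ‖b n t j‖ := norm_pos_iff.2 (hb0 _ _ _)
      have hLr : (0 : ℝ) < L := by exact_mod_cast hL0
      have h1 : (L : ℝ)⁻¹ ≤ δ * ‖b n t j‖ := by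
        have h2 := hR t ⟨j, Finset.mem_Iic.2 hj⟩
        have h3 : R ≤ L * δ := (div_le_iff₀ hδ).1 (hm.trans (by
          exact_mod_cast (show m ≤ L by omega)))
        have h4 : ‖b n t j‖⁻¹ ≤ L * δ := h2.trans h3
        rw [inv_le_iff_one_le_mul₀ hLr]
        rw [inv_le_iff_one_le_mul₀ hbj] at h4
        linarith
      have h2 : y P s i = (r P : 𝕜) * (((L : ℝ)⁻¹ : ℝ) : 𝕜) := by
        rw [← hv2 s i hi]
        exact if_neg (not_lt.2 h)
      rw [hy1 t j hj, h2, norm_mul, norm_mul, RCLike.norm_ofReal, RCLike.norm_ofReal,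
        abs_of_nonneg (hr0 _), abs_of_pos (inv_pos.2 hLr)]
      calc r P * (L : ℝ)⁻¹ ≤ r P * (δ * ‖b n t j‖) :=
            mul_le_mul_of_nonneg_left h1 (hr0 _)
        _ = δ * (r P * ‖b n t j‖) := by ring

/-- The difference equals (e - e' Y/Z) / (Z + e'), and the denominator has modulus at least R + 1.
-/
lemma norm_ratio_sub_le {Y Z e e' : 𝕜} {R : ℝ} (hR : 0 ≤ R) (hZ : R + 2 ≤ ‖Z‖) (he : ‖e‖ ≤ 1)
    (he' : ‖e'‖ ≤ 1) : ‖(Y + e) / (Z + e') - Y / Z‖ ≤ (1 + ‖Y / Z‖) / (R + 1) := by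
  have hZ0 : Z ≠ 0 := norm_pos_iff.1 (by linarith)
  have h1 : R + 1 ≤ ‖Z + e'‖ := by
    have := norm_sub_le_norm_add Z e'
    linarith
  have hZe : Z + e' ≠ 0 := norm_pos_iff.1 (by linarith)
  have h2 : (Y + e) / (Z + e') - Y / Z = (e - e' * (Y / Z)) / (Z + e') := by
    field_simp
    ring
  rw [h2, norm_div]
  refine div_le_div₀ (by positivity) ?_ (by linarith) h1
  refine (norm_sub_le _ _).trans (add_le_add he ?_)
  rw [norm_mul]
  exact mul_le_of_le_one_left (norm_nonneg _) he'

lemma weightProd_ne_zero_of_le {f : ℕ+ → ℕ+} {w : ℕ+ → 𝕜} {j : ℕ+} {m n : ℕ} (h : m ≤ n)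
    (hn : weightProd f w j n ≠ 0) : weightProd f w j m ≠ 0 := by
  obtain ⟨k, rfl⟩ := Nat.exists_eq_add_of_le h
  rw [weightProd_add] at hn
  exact left_ne_zero_of_mul hn

lemma exists_mem_ge_of_mem_familyUBD {A : Set ℕ} (hA : A ∈ familyUBD) (m : ℕ) :
    ∃ n ∈ A, m ≤ n := by
  obtain ⟨δ, hδ, hw⟩ := mem_familyUBD_iff.1 hA
  obtain ⟨M, hM, a, ha, hle⟩ := hw (m + 1)
  have h1 : (0 : ℝ) < ((A ∩ Set.Icc (a + 1) (a + M)).ncard : ℝ) :=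
    lt_of_lt_of_le (mul_pos hδ (by exact_mod_cast (show 0 < M by omega))) hle
  obtain ⟨n, hn, hn1, _⟩ := Set.nonempty_of_ncard_ne_zero
    (show (A ∩ Set.Icc (a + 1) (a + M)).ncard ≠ 0 by exact_mod_cast h1.ne')
  exact ⟨n, hn, by omega⟩

variable {p : ℝ≥0∞} [Fact (1 ≤ p)]

/-- If orbits of `x` return along a set of positive upper Banach density to a vector that is
supported on `[1, j]` and has a large `j`-th entry, then the reciprocal weight products
are summable. -/
lemma tsum_inv_weightProd_lt_top (hp : p ≠ ⊤) {f : ℕ+ → ℕ+} (hf : StrictMono f)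
    (hf1 : 1 < f 1) {w : ℕ+ → 𝕜} (hw : BddAbove (Set.range fun j => ‖w (f j)‖))
    {x : ℕ+ → 𝕜} {A : Set ℕ} (hA : A ∈ familyUBD) {j : ℕ+}
    {z : ℕ → lp (fun _ : ℕ+ => 𝕜) p} (hz : ∀ n ∈ A, ‖z n‖ ≤ 1)
    (hzx : ∀ n ∈ A, ∀ i, j < i → z n i = weightProd f w i n * x (f^[n] i))
    (hx : ∀ n ∈ A, 1 ≤ ‖weightProd f w j n * x (f^[n] j)‖) :
    ∑' n : ℕ+, 1 / ‖weightProd f w j n‖ₑ ^ p.toReal < ⊤ := by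
  have hp0 := toReal_pos_of_one_le hp
  -- The set A is unbounded, and a non-zero product at a later time forces non-zero earlier ones.
  have hW : ∀ n, weightProd f w j n ≠ 0 := fun n => by
    obtain ⟨m, hm, hnm⟩ := exists_mem_ge_of_mem_familyUBD hA n
    refine weightProd_ne_zero_of_le hnm fun h => ?_
    have := hx m hm
    rw [h, zero_mul, norm_zero] at this
    linarith
  obtain ⟨C, hC⟩ := hw
  set C' := max C 1 with hC'
  have hC0 : 0 < C' := lt_max_of_lt_right one_pos
  have hsum : Summable fun n => (‖weightProd f w j n‖ ^ p.toReal)⁻¹ := by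
    refine summable_of_bounded_returns hA (fun n => by positivity)
      (c := (C' ^ p.toReal)⁻¹) (by positivity) (fun n => ?_) (K := 1) fun n hn H => ?_
    · have h1 : ‖weightProd f w j (n + 1)‖ ≤ C' * ‖weightProd f w j n‖ := by
        rw [weightProd_succ, norm_mul, mul_comm]
        refine mul_le_mul_of_nonneg_right ?_ (norm_nonneg _)
        rw [Function.iterate_succ_apply']
        exact (hC ⟨_, rfl⟩).trans (le_max_left _ _)
      rw [← mul_inv, ← Real.mul_rpow hC0.le (norm_nonneg _)]
      exact inv_anti₀ (Real.rpow_pos_of_pos (norm_pos_iff.2 (hW _)) _)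
        (Real.rpow_le_rpow (norm_nonneg _) h1 hp0.le)
    -- Since W_{j,n+h} = W_{j,h} W_{f^h(j),n}, the lower bound at time n + h becomes a lower bound
    -- 1/|W_{j,h}| for the entry of `z n` at f^h(j). These positions are distinct, so the norm of `z
    -- n` bounds the sum.
    · have hterm : ∀ h, {k | n + k ∈ A}.indicator
          (fun n => (‖weightProd f w j n‖ ^ p.toReal)⁻¹) (h + 1) ≤
          ‖z n (f^[h + 1] j)‖ ^ p.toReal := by
        intro h
        by_cases hm : n + (h + 1) ∈ A
        · rw [Set.indicator_of_mem (by exact hm)]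
          have hlt : j < f^[h + 1] j := by
            have := iterate_left_strictMono hf hf1 j (Nat.succ_pos h)
            simpa using this
          rw [hzx n hn _ hlt, ← Function.iterate_add_apply]
          have h1 := hx _ hm
          rw [add_comm n (h + 1), weightProd_add, norm_mul, norm_mul] at h1
          rw [← Real.inv_rpow (norm_nonneg _)]
          refine Real.rpow_le_rpow (by positivity) ?_ hp0.le
          rw [inv_le_iff_one_le_mul₀ (norm_pos_iff.2 (hW _)), norm_mul, add_comm n (h + 1)]
          linarith
        · rw [Set.indicator_of_notMem (by exact hm)]
          positivity
      have hinj : Function.Injective fun h : ℕ => f^[h + 1] j := fun a b h => by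
        have := (iterate_left_strictMono hf hf1 j).injective h
        omega
      have hs := (lp.memℓp (z n)).summable hp0
      calc _ ≤ ∑ h ∈ Finset.range H, ‖z n (f^[h + 1] j)‖ ^ p.toReal :=
            Finset.sum_le_sum fun h _ => hterm h
        _ ≤ ∑' h : ℕ, ‖z n (f^[h + 1] j)‖ ^ p.toReal :=
            (hs.comp_injective hinj).sum_le_tsum _ fun _ _ => by positivity
        _ ≤ ∑' i, ‖z n i‖ ^ p.toReal :=
            tsum_comp_le_tsum_of_inj hs (fun _ => by positivity) hinj
        _ = ‖z n‖ ^ p.toReal := (lp.norm_rpow_eq_tsum hp0 _).symm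
        _ ≤ 1 := Real.rpow_le_one (norm_nonneg _) (hz n hn) hp0.le
  have h1 := (hsum.comp_injective PNat.coe_injective).tsum_ofReal_lt_top
  refine lt_of_le_of_lt (le_of_eq (tsum_congr fun n => ?_)) h1
  have h2 : 0 < ‖weightProd f w j n‖ ^ p.toReal :=
    Real.rpow_pos_of_pos (norm_pos_iff.2 (hW _)) _
  rw [Function.comp_apply, ENNReal.ofReal_inv_of_pos h2,
    ← ENNReal.ofReal_rpow_of_nonneg (norm_nonneg _) hp0.le, ofReal_norm, one_div]

/-- Multiplying numerator and denominator by the common coordinate of x turns each ratio into an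
entry of z over a number of modulus at least c. Different m use different entries, because iterates
of g strictly increase along an orbit. -/
lemma tsum_weight_ratio_le (hp : p ≠ ⊤) {f g : ℕ+ → ℕ+} (hf : StrictMono f)
    (hg : StrictMono g) (hg1 : 1 < g 1) (w v : ℕ+ → 𝕜) {x : ℕ+ → 𝕜} {j k : ℕ+} {n : ℕ}
    {c : ℝ} (hc : 0 < c) {z : lp (fun _ : ℕ+ => 𝕜) p}
    (hz : ∀ i, k < i → z i = weightProd f w i n * x (f^[n] i)) {P : ℕ → Prop}
    (hP : ∀ m, P m → c ≤ ‖weightProd g v j m * x (g^[m] j)‖)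
    (hP' : ∀ m, P m → g^[m] j ∈ f^[n] '' Set.Ioi k) :
    ∑' m : {m : ℕ // P m}, ‖weightProd f w (iterInv f n (g^[m] j)) n‖ₑ ^ p.toReal /
      ‖weightProd g v j m‖ₑ ^ p.toReal ≤ ENNReal.ofReal (‖z‖ / c) ^ p.toReal := by
  have hp0 := toReal_pos_of_one_le hp
  have hterm : ∀ m : {m : ℕ // P m},
      ‖weightProd f w (iterInv f n (g^[m] j)) n‖ₑ ^ p.toReal /
        ‖weightProd g v j m‖ₑ ^ p.toReal ≤
      ‖z (iterInv f n (g^[m] j))‖ₑ ^ p.toReal * (ENNReal.ofReal c ^ p.toReal)⁻¹ := by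
    rintro ⟨m, hm⟩
    obtain ⟨i, hi, him⟩ := hP' m hm
    simp only [← him, iterInv_iterate hf, hz i hi]
    have h1 : ENNReal.ofReal c ≤ ‖weightProd g v j m‖ₑ * ‖x (f^[n] i)‖ₑ := by
      rw [him, ← enorm_mul, ← ofReal_norm]
      exact ENNReal.ofReal_le_ofReal (hP m hm)
    have hx0 : ‖x (f^[n] i)‖ₑ ≠ 0 := by
      intro h
      rw [h, mul_zero, nonpos_iff_eq_zero, ENNReal.ofReal_eq_zero] at h1
      linarith
    rw [enorm_mul, ← div_eq_mul_inv, ← ENNReal.div_rpow_of_nonneg _ _ hp0.le,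
      ← ENNReal.div_rpow_of_nonneg _ _ hp0.le]
    refine ENNReal.rpow_le_rpow ?_ hp0.le
    rw [← ENNReal.mul_div_mul_right _ _ hx0 enorm_ne_top]
    exact ENNReal.div_le_div_left h1 _
  refine (ENNReal.tsum_le_tsum hterm).trans ?_
  rw [ENNReal.tsum_mul_right]
  have hinj : Function.Injective fun m : {m : ℕ // P m} => iterInv f n (g^[m] j) := by
    rintro ⟨m, hm⟩ ⟨m', hm'⟩ h
    obtain ⟨i, hi, him⟩ := hP' m hm
    obtain ⟨i', hi', him'⟩ := hP' m' hm'
    simp only [← him, ← him', iterInv_iterate hf] at h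
    subst h
    exact Subtype.ext ((iterate_left_strictMono hg hg1 j).injective (him.symm.trans him'))
  have h2 := ENNReal.tsum_comp_le_tsum_of_injective hinj fun i => ‖z i‖ₑ ^ p.toReal
  rw [tsum_enorm_rpow hp] at h2
  refine (mul_le_mul_left h2 _).trans (le_of_eq ?_)
  rw [← div_eq_mul_inv, ← ENNReal.div_rpow_of_nonneg _ _ hp0.le, ENNReal.ofReal_div_of_pos hc,
    ofReal_norm]


theorem exists_sets_of_disjointHypercyclic {𝕜 : Type*} [RCLike 𝕜] (p : ℝ≥0∞) [Fact (1 ≤ p)]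
    (hp : p ≠ ⊤) (N : ℕ)
    (f : Fin N → ℕ+ → ℕ+) (hf : ∀ s, StrictMono (f s)) (hf1 : ∀ s, 1 < f s 1)
    (w : Fin N → ℕ+ → 𝕜) (hw : ∀ s, BddAbove (Set.range fun j => ‖w s (f s j)‖))
    (𝒜 : Set (Set ℕ)) (h𝒜 : 𝒜 ⊆ familyUBD)
    (hT : DisjointHypercyclic 𝒜 (fun s => pseudoShift p (f s) (hf s) (w s) (hw s))) :
      ∃ (A : ℕ+ → Set ℕ) (ε : ℕ+ → ℝ),
        (∀ k, A k ∈ 𝒜) ∧ (∀ k, 0 < ε k) ∧ Tendsto ε atTop (𝓝 0) ∧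
        -- (1)
        (∀ (j : ℕ+) (s : Fin N),
          ∑' n : ℕ+, 1 / ‖weightProd (f s) (w s) j n‖ₑ ^ p.toReal < ⊤) ∧
        -- (2)
        (∀ j l : ℕ+, j ≤ l → ∀ k : ℕ+, ∀ n ∈ A k, ∀ s t : Fin N, s ≠ t →
          ∑' m : {m : ℕ // m ∈ A l \ {n} ∧ (f t)^[m] j ∈ (f s)^[n] '' Set.Ioi k},
            ‖weightProd (f s) (w s)
                (iterInv (f s) n ((f t)^[m] j)) n‖ₑ ^ p.toReal /
              ‖weightProd (f t) (w t) j m‖ₑ ^ p.toReal ≤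
            ENNReal.ofReal (ε l)) ∧
        -- (3)
        (∀ j k l : ℕ+, j ≤ k → k < l → ∀ n ∈ A l, ∀ s t : Fin N, s ≠ t →
          ∑' m : {m : ℕ // m ∈ A k ∧ (f t)^[m] j ∈ (f s)^[n] '' Set.Ioi l},
            ‖weightProd (f s) (w s)
                (iterInv (f s) n ((f t)^[m] j)) n‖ₑ ^ p.toReal /
              ‖weightProd (f t) (w t) j m‖ₑ ^ p.toReal ≤
            ENNReal.ofReal (ε l)) ∧
        -- (4)
        (∀ (l : ℕ+) (a : Fin N → ℕ+ → 𝕜), (∀ s, ∀ j ≤ l, a s j ≠ 0) →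
          ∀ δ : ℝ, 0 < δ → ∃ L : ℕ+, l ≤ L ∧ ∀ s t : Fin N, s ≠ t → ∀ n ∈ A L,
            (∀ j ∈ ((f t)^[n] '' Set.Iic l) ∩ ((f s)^[n] '' Set.Iic l),
              ‖weightProd (f s) (w s) (iterInv (f s) n j) n /
                  weightProd (f t) (w t) (iterInv (f t) n j) n -
                a s (iterInv (f s) n j) /
                  a t (iterInv (f t) n j)‖ ≤ δ) ∧
            (∀ j ∈ ((f t)^[n] '' Set.Iic l) ∩ ((f s)^[n] '' Set.Ioi l),
              ‖weightProd (f s) (w s) (iterInv (f s) n j) n‖ /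
                  ‖weightProd (f t) (w t)
                    (iterInv (f t) n j) n‖ ≤ δ)) := by
  have hp0 := toReal_pos_of_one_le hp
  have hp1 := one_le_toReal hp
  obtain ⟨x, hx⟩ := hT
  obtain ⟨y, hy0, hyL, hyd⟩ := exists_targets 𝕜 N
  have hmem : ∀ k s, Memℓp (y k s) p := fun k s =>
    (memℓp_gen_iff hp0).2 (summable_of_hasFiniteSupport
      ((Finset.finite_toSet (Finset.Iic k)).subset fun j hj => by
        rw [Finset.coe_Iic, Set.mem_Iic]
        by_contra h
        refine hj ?_
        simp only [hy0 k s j (not_le.1 h), norm_zero, Real.zero_rpow hp0.ne']))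
  set Y : ℕ+ → Fin N → lp (fun _ : ℕ+ => 𝕜) p := fun k s => ⟨y k s, hmem k s⟩ with hY
  set ε : ℕ+ → ℝ := fun k => 1 / ((k : ℕ) + 1 : ℝ) with hε
  have hε0 : ∀ k, 0 < ε k := fun k => by simp only [hε]; positivity
  have hε1 : ∀ k, ε k ≤ 1 := fun k => by
    simp only [hε]
    rw [div_le_one (by positivity)]
    have : (0 : ℝ) ≤ (k : ℕ) := by positivity
    linarith
  set z : ℕ+ → ℕ → Fin N → lp (fun _ : ℕ+ => 𝕜) p := fun k n s =>
    (pseudoShift p (f s) (hf s) (w s) (hw s) ^ n) x - Y k s with hz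
  set A : ℕ+ → Set ℕ := fun k => {n | ∀ s, ‖z k n s‖ < ε k} with hA
  have hA𝒜 : ∀ k, A k ∈ 𝒜 := fun k => by
    have h1 := hx (Metric.ball (Y k) (ε k)) Metric.isOpen_ball ⟨Y k, Metric.mem_ball_self (hε0 k)⟩
    have h2 : A k = {n | (ContinuousLinearMap.piMap
        (fun s => pseudoShift p (f s) (hf s) (w s) (hw s)) ^ n) (fun _ => x) ∈
          Metric.ball (Y k) (ε k)} := by
      ext n
      rw [Set.mem_ofPred_eq, Set.mem_ofPred_eq, Metric.mem_ball, dist_pi_lt_iff (hε0 k)]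
      exact forall_congr' fun s => by rw [piMap_pow_apply, dist_eq_norm]
    rw [h2]
    exact h1
  have hzj : ∀ k n s j, z k n s j =
      weightProd (f s) (w s) j n * x ((f s)^[n] j) - y k s j := fun k n s j => by
    rw [← pseudoShift_pow_apply p (f s) (hf s) (w s) (hw s)]
    rfl
  have hzle : ∀ k, ∀ n ∈ A k, ∀ s j, ‖z k n s j‖ ≤ 1 := fun k n hn s j =>
    (lp.norm_apply_le_norm (by
      intro h
      simp [h] at hp0) (z k n s) j).trans ((hn s).le.trans (hε1 k))
  have hWx : ∀ k n s j, weightProd (f s) (w s) j n * x ((f s)^[n] j) = y k s j + z k n s j :=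
    fun k n s j => by rw [hzj]; ring
  have hztail : ∀ k n s i, k < i →
      z k n s i = weightProd (f s) (w s) i n * x ((f s)^[n] i) := fun k n s i hi => by
    rw [hzj, hy0 k s i hi, sub_zero]
  have hWlarge : ∀ k, ∀ n ∈ A k, ∀ s, ∀ j ≤ k,
      (k : ℝ) + 1 ≤ ‖weightProd (f s) (w s) j n * x ((f s)^[n] j)‖ := fun k n hn s j hj => by
    rw [hWx k]
    have h1 := norm_sub_le_norm_add (y k s j) (z k n s j)
    have h2 := hyL k s j hj
    have h3 := hzle k n hn s j
    linarith
  have hk0 : ∀ k : ℕ+, (1 : ℝ) ≤ (k : ℝ) + 1 := fun k => by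
    have : (0 : ℝ) ≤ (k : ℝ) := by positivity
    linarith
  refine ⟨A, ε, hA𝒜, hε0, ?_, ?_, ?_, ?_, ?_⟩
  · refine (tendsto_one_div_add_atTop_nhds_zero_nat (𝕜 := ℝ)).comp ?_
    exact tendsto_atTop_atTop.2 fun b => ⟨b.succPNat, fun a ha => by
      have h1 : b + 1 ≤ (a : ℕ) := by simpa using PNat.coe_le_coe _ _ |>.2 ha
      omega⟩
  · intro j s
    exact tsum_inv_weightProd_lt_top hp (hf s) (hf1 s) (hw s) (h𝒜 (hA𝒜 j))
      (z := fun n => z j n s) (fun n hn => (hn s).le.trans (hε1 j))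
      (fun n hn i hi => hztail j n s i hi)
      (fun n hn => (hk0 j).trans (hWlarge j n hn s j le_rfl))
  · intro j l hjl k n hn s t hst
    refine (tsum_weight_ratio_le hp (hf s) (hf t) (hf1 t) (w s) (w t)
      (c := (l : ℝ) + 1) (by positivity) (z := z k n s) (fun i hi => hztail k n s i hi)
      (fun m hm => hWlarge l m hm.1.1 t j hjl) (fun m hm => hm.2)).trans ?_
    rw [ENNReal.ofReal_rpow_of_nonneg (by positivity) hp0.le]
    refine ENNReal.ofReal_le_ofReal ?_
    -- The decay in l comes from the size of the targets at level l; in (3) it comes from the error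
    -- at level l. The exponent p is dropped using ε_l ≤ 1 ≤ p.
    have h1 : ‖z k n s‖ / ((l : ℝ) + 1) ≤ ε l :=
      div_le_div_of_nonneg_right ((hn s).le.trans (hε1 k)) (by positivity)
    exact (Real.rpow_le_rpow (by positivity) h1 hp0.le).trans
      (Real.rpow_le_self_of_le_one (hε0 l).le (hε1 l) hp1)
  · intro j k l hjk hkl n hn s t hst
    refine (tsum_weight_ratio_le hp (hf s) (hf t) (hf1 t) (w s) (w t)
      (c := (k : ℝ) + 1) (by positivity) (z := z l n s) (fun i hi => hztail l n s i hi)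
      (fun m hm => hWlarge k m hm.1 t j hjk) (fun m hm => hm.2)).trans ?_
    rw [ENNReal.ofReal_rpow_of_nonneg (by positivity) hp0.le]
    refine ENNReal.ofReal_le_ofReal ?_
    have h1 : ‖z l n s‖ / ((k : ℝ) + 1) ≤ ε l :=
      (div_le_self (norm_nonneg _) (hk0 k)).trans (hn s).le
    exact (Real.rpow_le_rpow (by positivity) h1 hp0.le).trans
      (Real.rpow_le_self_of_le_one (hε0 l).le (hε1 l) hp1)
  · intro l a ha δ hδ
    obtain ⟨R, hR⟩ : ∃ R : ℝ, ∀ (s t : Fin N) (i j : ℕ+), i ≤ l → j ≤ l →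
        ‖a s i / a t j‖ ≤ R := by
      obtain ⟨R, hR⟩ := (Set.finite_range fun q : Fin N × Fin N × Finset.Iic l × Finset.Iic l =>
        ‖a q.1 q.2.2.1 / a q.2.1 q.2.2.2‖).bddAbove
      exact ⟨R, fun s t i j hi hj =>
        hR ⟨(s, t, ⟨i, Finset.mem_Iic.2 hi⟩, ⟨j, Finset.mem_Iic.2 hj⟩), rfl⟩⟩
    set η := min (δ / 4) 1 with hη
    have hη0 : 0 < η := lt_min (by positivity) one_pos
    have hηδ : η ≤ δ / 4 := min_le_left _ _
    have hη1 : η ≤ 1 := min_le_right _ _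
    -- Target ratios are bounded by 1 + |R| as η ≤ 1, so for L ≥ L₀ replacing targets by orbit
    -- entries changes them by at most δ/2; the targets themselves cost η ≤ δ/4.
    obtain ⟨L₀, hL₀⟩ := exists_nat_ge (2 * (2 + |R|) / δ)
    obtain ⟨L, hL₀L, hlL, hLa, hLb⟩ := hyd l a ha η hη0 L₀
    have hLδ : 2 * (2 + |R|) ≤ ((L : ℝ) + 1) * δ := by
      rw [div_le_iff₀ hδ] at hL₀
      refine hL₀.trans (mul_le_mul_of_nonneg_right ?_ hδ.le)
      have : (L₀ : ℝ) ≤ (L : ℝ) := by exact_mod_cast hL₀L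
      linarith
    have hL0 : (0 : ℝ) < (L : ℝ) + 1 := by positivity
    refine ⟨L, hlL, fun s t hst n hn => ⟨?_, ?_⟩⟩
    · rintro _ ⟨⟨j, hj, rfl⟩, ⟨i, hi, hij⟩⟩
      rw [Set.mem_Iic] at hi hj
      rw [iterInv_iterate (hf t), ← hij, iterInv_iterate (hf s)]
      have hxne : x ((f t)^[n] j) ≠ 0 := fun h => by
        have := hWlarge L n hn t j (hj.trans hlL)
        rw [h, mul_zero, norm_zero] at this
        linarith
      have h1 := hWx L n s i
      rw [hij] at h1
      have h2 := hWx L n t j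
      rw [← mul_div_mul_right _ _ hxne, h1, h2]
      have h3 := norm_ratio_sub_le (Y := y L s i) (Z := y L t j) (R := (L : ℝ)) (by positivity)
        (hyL L t j (hj.trans hlL)) (hzle L n hn s i) (hzle L n hn t j)
      have h4 := hLa s t i j hi hj
      have h5 : ‖y L s i / y L t j‖ ≤ 1 + |R| := by
        have := norm_le_norm_sub_add (y L s i / y L t j) (a s i / a t j)
        have h6 := (hR s t i j hi hj).trans (le_abs_self R)
        linarith
      have h6 : (1 + ‖y L s i / y L t j‖) / ((L : ℝ) + 1) ≤ δ / 2 := by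
        rw [div_le_iff₀ hL0]
        linarith
      have h7 := norm_sub_le_norm_sub_add_norm_sub ((y L s i + z L n s i) /
        (y L t j + z L n t j)) (y L s i / y L t j) (a s i / a t j)
      linarith
    · rintro _ ⟨⟨j, hj, rfl⟩, ⟨i, hi, hij⟩⟩
      rw [Set.mem_Iic] at hj
      rw [Set.mem_Ioi] at hi
      rw [iterInv_iterate (hf t), ← hij, iterInv_iterate (hf s)]
      have hxne : 0 < ‖x ((f t)^[n] j)‖ := norm_pos_iff.2 fun h => by
        have := hWlarge L n hn t j (hj.trans hlL)
        rw [h, mul_zero, norm_zero] at this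
        linarith
      have h1 := hWx L n s i
      rw [hij] at h1
      have h2 := hWx L n t j
      rw [← mul_div_mul_right _ _ hxne.ne', ← norm_mul, ← norm_mul, h1, h2]
      have h3 := hyL L t j (hj.trans hlL)
      have h4 := norm_sub_le_norm_add (y L t j) (z L n t j)
      have h5 := hzle L n hn t j
      have h6 := (norm_add_le (y L s i) (z L n s i)).trans
        (add_le_add (hLb s t i j hi hj) (hzle L n hn s i))
      rw [div_le_iff₀ (by linarith)]
      have h7 : η * ‖y L t j‖ ≤ δ / 4 * ‖y L t j‖ :=
        mul_le_mul_of_nonneg_right hηδ (norm_nonneg _)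
      have h8 : δ * (‖y L t j‖ - 1) ≤ δ * ‖y L t j + z L n t j‖ :=
        mul_le_mul_of_nonneg_left (by linarith) hδ.le
      have h9 : δ * (L + 2) ≤ δ * ‖y L t j‖ := mul_le_mul_of_nonneg_left h3 hδ.le
      have h10 := abs_nonneg R
      nlinarith [mul_pos hδ hL0]

end Necessity

/-! ### Sums in `[0, ∞]` -/

/-- The function φ may have infinite fibres: a finite set carries nearly all the mass, and its
maximal φ-value is eventually exceeded by G. -/
lemma tendsto_tsum_tail {ι : Type*} {g : ι → ℝ≥0∞} (hg : ∑' i, g i ≠ ⊤) (φ : ι → ℕ) :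
    Tendsto (fun G : ℕ => ∑' i, if G < φ i then g i else 0) atTop (𝓝 0) := by
  classical
  rw [ENNReal.tendsto_nhds_zero]
  intro ε hε
  obtain ⟨s, hs⟩ := ((ENNReal.tendsto_nhds_zero.1
    (ENNReal.tendsto_tsum_compl_atTop_zero hg)) ε hε).exists
  filter_upwards [eventually_ge_atTop (s.sup φ)] with G hG
  refine le_trans ?_ hs
  refine le_trans (ENNReal.tsum_le_tsum fun i => ?_)
    (le_of_eq (tsum_subtype {i | i ∉ s} g).symm)
  split_ifs with h
  · rw [Set.indicator_of_mem]
    intro hi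
    exact absurd (Finset.le_sup (f := φ) hi) (by omega)
  · exact zero_le

lemma le_tsum_of_cover {ι Ω : Type*} {g : ι → ℝ≥0∞} (v : Ω → ℝ≥0∞) (pos : Ω → ι) {i : ι}
    {ω : Ω} (hω : pos ω = i) (h : g i ≤ v ω) :
    g i ≤ ∑' ω : Ω, Set.indicator {i | pos ω = i} (fun _ => v ω) i :=
  (h.trans (by simp [hω])).trans (ENNReal.le_tsum ω)

lemma tsum_tsum_indicator {ι Ω : Type*} (v : Ω → ℝ≥0∞) (pos : Ω → ι) :
    ∑' i, ∑' ω : Ω, Set.indicator {i | pos ω = i} (fun _ => v ω) i = ∑' ω, v ω := by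
  classical
  rw [ENNReal.tsum_comm]
  refine tsum_congr fun ω => ?_
  rw [tsum_eq_single (pos ω) fun i hi => Set.indicator_of_notMem (fun h => hi h.symm) _]
  simp

/-- Every ω has only one position, so distinct i are charged to distinct ω. Several prescriptions
may share a position, so `pos` need not be injective. -/
lemma tsum_le_tsum_of_cover {ι Ω : Type*} {g : ι → ℝ≥0∞} (v : Ω → ℝ≥0∞) (pos : Ω → ι)
    (h : ∀ i, g i ≠ 0 → ∃ ω, pos ω = i ∧ g i ≤ v ω) : ∑' i, g i ≤ ∑' ω, v ω := by
  rw [← tsum_tsum_indicator v pos]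
  refine ENNReal.tsum_le_tsum fun i => ?_
  by_cases hi : g i = 0
  · rw [hi]; exact zero_le
  · obtain ⟨ω, h1, h2⟩ := h i hi
    exact le_tsum_of_cover v pos h1 h2

lemma tsum_le_tsum_of_cover₃ {ι Ω₁ Ω₂ Ω₃ : Type*} {g : ι → ℝ≥0∞} (v₁ : Ω₁ → ℝ≥0∞)
    (v₂ : Ω₂ → ℝ≥0∞) (v₃ : Ω₃ → ℝ≥0∞) (pos₁ : Ω₁ → ι) (pos₂ : Ω₂ → ι) (pos₃ : Ω₃ → ι)
    (h : ∀ i, g i ≠ 0 → (∃ ω, pos₁ ω = i ∧ g i ≤ v₁ ω) ∨ (∃ ω, pos₂ ω = i ∧ g i ≤ v₂ ω) ∨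
      (∃ ω, pos₃ ω = i ∧ g i ≤ v₃ ω)) :
    ∑' i, g i ≤ ∑' ω, v₁ ω + ∑' ω, v₂ ω + ∑' ω, v₃ ω := by
  rw [← tsum_tsum_indicator v₁ pos₁, ← tsum_tsum_indicator v₂ pos₂,
    ← tsum_tsum_indicator v₃ pos₃, ← ENNReal.tsum_add, ← ENNReal.tsum_add]
  refine ENNReal.tsum_le_tsum fun i => ?_
  by_cases hi : g i = 0
  · rw [hi]; exact zero_le
  · rcases h i hi with ⟨ω, h1, h2⟩ | ⟨ω, h1, h2⟩ | ⟨ω, h1, h2⟩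
    · exact (le_tsum_of_cover v₁ pos₁ h1 h2).trans (le_self_add.trans le_self_add)
    · exact (le_tsum_of_cover v₂ pos₂ h1 h2).trans (le_add_self.trans le_self_add)
    · exact (le_tsum_of_cover v₃ pos₃ h1 h2).trans le_add_self

lemma tsum_two_inv_pow_add (r : ℕ) : ∑' q : ℕ, (2⁻¹ : ℝ≥0∞) ^ (q + r) = 2 * 2⁻¹ ^ r := by
  simp_rw [pow_add]
  rw [ENNReal.tsum_mul_right, ENNReal.tsum_geometric, ENNReal.one_sub_inv_two, inv_inv]

/-- Choice of the parameters in the construction of a hypercyclic vector. -/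
lemma exists_parameters {M : ℕ → ℝ≥0∞} (hM : ∀ q, M q ≠ ⊤) {e : ℕ+ → ℝ≥0∞}
    (he : Tendsto e atTop (𝓝 0)) {τ : ℕ → ℕ+ → ℝ≥0∞} (hτ : ∀ r, Tendsto (τ r) atTop (𝓝 0))
    {κ : ℕ → ℕ+ → ℕ → ℝ≥0∞} (hκ : ∀ q l, Tendsto (κ q l) atTop (𝓝 0))
    {P : ℕ → ℕ+ → ℝ → ℕ+ → Prop} (hP : ∀ r l δ, 0 < δ → ∃ L, l ≤ L ∧ P r l δ L)
    {x : ℝ} (hx : 0 < x) :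
    ∃ (l L : ℕ → ℕ+) (G : ℕ → ℕ) (δ : ℕ → ℝ), Monotone G ∧
      (∀ r, l r ≤ L r ∧ (L r : ℕ) ≤ G r ∧ τ r (l r) ≤ 2⁻¹ ^ r ∧
        ENNReal.ofReal (δ r) ^ x * M r ≤ 2⁻¹ ^ r ∧ P r (l r) (δ r) (L r)) ∧
      ∀ q r, M q * e (max (L q) (L r)) ≤ 2⁻¹ ^ (q + r) ∧
        κ q (l q) (max (G q) (G r)) ≤ 2⁻¹ ^ (q + r) := by
  have hpos : ∀ n : ℕ, (0 : ℝ≥0∞) < 2⁻¹ ^ n := fun n => ENNReal.pow_pos (by simp) n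
  have hmono : ∀ q r n : ℕ, q ≤ n → r ≤ n → (2⁻¹ : ℝ≥0∞) ^ (n + n) ≤ 2⁻¹ ^ (q + r) :=
    fun q r n hq hr => pow_le_pow_right_of_le_one' (by simp) (by omega)
  have h1 : ∀ r, ∃ l : ℕ+, (∀ k ≥ l, ∀ q ≤ r, M q * e k ≤ 2⁻¹ ^ (r + r)) ∧
      τ r l ≤ 2⁻¹ ^ r := by
    intro r
    have hev : ∀ᶠ k in atTop, ∀ q ∈ Finset.Iic r, M q * e k ≤ 2⁻¹ ^ (r + r) := by
      refine (Finset.eventually_all _).2 fun q _ => ?_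
      have h2 := ENNReal.Tendsto.const_mul he (Or.inr (hM q))
      rw [mul_zero] at h2
      exact ENNReal.tendsto_nhds_zero.1 h2 _ (hpos _)
    obtain ⟨l, hl1, hl2⟩ := ((eventually_forall_ge_atTop.2 hev).and
      (ENNReal.tendsto_nhds_zero.1 (hτ r) _ (hpos r))).exists
    exact ⟨l, fun k hk q hq => hl1 k hk q (Finset.mem_Iic.2 hq), hl2⟩
  have h2 : ∀ r, ∃ δ : ℝ, 0 < δ ∧ ENNReal.ofReal δ ^ x * M r ≤ 2⁻¹ ^ r := by
    intro r
    have h3 : Tendsto (fun δ : ℝ => ENNReal.ofReal δ ^ x * M r) (𝓝[>] 0) (𝓝 0) := by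
      have h4 : Tendsto (fun δ : ℝ => ENNReal.ofReal δ ^ x) (𝓝[>] 0) (𝓝 0) := by
        have h5 := (((ENNReal.continuous_rpow_const (y := x)).comp
          ENNReal.continuous_ofReal).tendsto 0).mono_left (nhdsWithin_le_nhds (s := Set.Ioi 0))
        simpa [ENNReal.zero_rpow_of_pos hx, Function.comp_def] using h5
      simpa using ENNReal.Tendsto.mul_const h4 (Or.inr (hM r))
    obtain ⟨δ, hδ1, hδ2⟩ := ((ENNReal.tendsto_nhds_zero.1 h3 _ (hpos r)).and
      self_mem_nhdsWithin).exists
    exact ⟨δ, hδ2, hδ1⟩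
  choose l hl1 hl2 using h1
  choose δ hδ0 hδ using h2
  choose L hlL hL using fun r => hP r (l r) (δ r) (hδ0 r)
  have h3 : ∀ r, ∃ g : ℕ, (L r : ℕ) ≤ g ∧ ∀ G ≥ g, ∀ q ≤ r, κ q (l q) G ≤ 2⁻¹ ^ (r + r) := by
    intro r
    have hev : ∀ᶠ k in atTop, ∀ q ∈ Finset.Iic r, κ q (l q) k ≤ 2⁻¹ ^ (r + r) :=
      (Finset.eventually_all _).2 fun q _ => ENNReal.tendsto_nhds_zero.1 (hκ q (l q)) _ (hpos _)
    obtain ⟨g, hg1, hg2⟩ := ((eventually_ge_atTop (L r : ℕ)).and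
      (eventually_forall_ge_atTop.2 hev)).exists
    exact ⟨g, hg1, fun k hk q hq => hg2 k hk q (Finset.mem_Iic.2 hq)⟩
  choose g hg1 hg2 using h3
  -- Partial sums make G monotone. The pair bounds are arranged at the larger index n of q and r,
  -- with 2^{-2n} ≤ 2^{-(q+r)}.
  set G : ℕ → ℕ := fun r => ∑ i ∈ Finset.range (r + 1), g i with hG
  have hgG : ∀ r, g r ≤ G r := fun r =>
    Finset.single_le_sum (f := g) (fun _ _ => Nat.zero_le _) (Finset.self_mem_range_succ r)
  refine ⟨l, L, G, δ, fun a b hab => Finset.sum_le_sum_of_subset (Finset.range_mono (by omega)),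
    fun r => ⟨hlL r, (hg1 r).trans (hgG r), hl2 r, hδ r, hL r⟩, fun q r => ?_⟩
  rcases le_total q r with h | h
  · exact ⟨(hl1 r _ ((hlL r).trans (le_max_right _ _)) q h).trans (hmono q r r h le_rfl),
      (hg2 r _ ((hgG r).trans (le_max_right _ _)) q h).trans (hmono q r r h le_rfl)⟩
  · exact ⟨(hl1 q _ ((hlL q).trans (le_max_left _ _)) q le_rfl).trans (hmono q r q le_rfl h),
      (hg2 q _ ((hgG q).trans (le_max_left _ _)) q le_rfl).trans (hmono q r q le_rfl h)⟩

/-! ### Dense sequences of tuples without zero entries -/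

section Dense

variable {𝕜 : Type*} [RCLike 𝕜] {p : ℝ≥0∞} [Fact (1 ≤ p)]

lemma separableSpace_lp (hp : p ≠ ⊤) :
    TopologicalSpace.SeparableSpace (lp (fun _ : ℕ+ => 𝕜) p) := by
  rw [← TopologicalSpace.isSeparable_univ_iff]
  have h1 : TopologicalSpace.IsSeparable
      (Set.range fun j : ℕ+ => (lp.single p j (1 : 𝕜) : lp (fun _ : ℕ+ => 𝕜) p)) :=
    (Set.countable_range _).isSeparable
  refine (h1.span (R := 𝕜)).closure.mono fun x _ => ?_
  refine mem_closure_of_tendsto (lp.hasSum_single hp x) (Eventually.of_forall fun s => ?_)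
  refine Submodule.sum_mem _ fun j _ => ?_
  have h2 : lp.single p j (x j) = x j • (lp.single p j (1 : 𝕜) : lp (fun _ : ℕ+ => 𝕜) p) := by
    rw [← lp.single_smul, smul_eq_mul, mul_one]
  rw [h2]
  exact Submodule.smul_mem _ _ (Submodule.subset_span ⟨j, rfl⟩)

lemma continuous_lp_coord (hp : p ≠ ⊤) (j : ℕ+) :
    Continuous fun x : lp (fun _ : ℕ+ => 𝕜) p => x j := by
  have hp0 : p ≠ 0 := fun h => by
    have := toReal_pos_of_one_le hp
    simp [h] at this
  refine continuous_iff_continuousAt.2 fun x => tendsto_iff_norm_sub_tendsto_zero.2 ?_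
  refine squeeze_zero (fun _ => norm_nonneg _)
    (fun y => lp.norm_apply_le_norm hp0 (y - x) j)
    (tendsto_iff_norm_sub_tendsto_zero.1 tendsto_id)

/-- Baire's theorem: non-vanishing of one coordinate is an open dense condition. Zero entries must
be avoided because (4) concerns ratios. Each tuple is repeated infinitely often, so approximations
occur at arbitrarily large r. -/
lemma exists_dense_nonzero (𝕜 : Type*) [RCLike 𝕜] (hp : p ≠ ⊤) (N : ℕ) :
    ∃ a : ℕ → Fin N → lp (fun _ : ℕ+ => 𝕜) p, (∀ r s j, a r s j ≠ 0) ∧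
      ∀ U : Set (Fin N → lp (fun _ : ℕ+ => 𝕜) p), IsOpen U → U.Nonempty →
        ∀ r₀, ∃ r ≥ r₀, a r ∈ U := by
  classical
  have := separableSpace_lp (𝕜 := 𝕜) hp
  have : SecondCountableTopology (Fin N → lp (fun _ : ℕ+ => 𝕜) p) :=
    UniformSpace.secondCountable_of_separable _
  set V : Fin N × ℕ+ → Set (Fin N → lp (fun _ : ℕ+ => 𝕜) p) := fun q => {y | y q.1 q.2 ≠ 0}
    with hV
  have hVo : ∀ q, IsOpen (V q) := fun q =>
    isOpen_ne_fun ((continuous_lp_coord hp q.2).comp (continuous_apply q.1)) continuous_const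
  have hVd : ∀ q, Dense (V q) := by
    rintro ⟨s, j⟩ y
    by_cases hy : y s j = 0
    · set e : Fin N → lp (fun _ : ℕ+ => 𝕜) p := Pi.single s (lp.single p j (1 : 𝕜)) with he
      have h1 : Tendsto (fun c : 𝕜 => y + c • e) (𝓝[≠] 0) (𝓝 y) := by
        have h2 : Continuous fun c : 𝕜 => y + c • e := by fun_prop
        have h3 := (h2.tendsto 0).mono_left (nhdsWithin_le_nhds (s := {0}ᶜ))
        simpa using h3
      refine mem_closure_of_tendsto h1 ?_
      filter_upwards [self_mem_nhdsWithin] with c hc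
      have h4 : (y + c • e) s j = y s j + c * e s j := rfl
      have h5 : e s j = 1 := by simp [he]
      simp only [hV, Set.mem_ofPred_eq]
      rw [h4, hy, h5, zero_add, mul_one]
      exact hc
    · exact subset_closure hy
  have hd : Dense (⋂ q, V q) := dense_iInter_of_isOpen hVo hVd
  obtain ⟨t, htV, htc, htd⟩ := hd.exists_countable_dense_subset
  have htne : t.Nonempty := by
    obtain ⟨x, _, hx⟩ := htd.inter_open_nonempty _ isOpen_univ ⟨0, trivial⟩
    exact ⟨x, hx⟩
  obtain ⟨d, rfl⟩ := htc.exists_eq_range htne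
  refine ⟨fun r => d (Nat.unpair r).1, fun r s j => ?_, fun U hU hne r₀ => ?_⟩
  · exact Set.mem_iInter.1 (htV ⟨(Nat.unpair r).1, rfl⟩) (s, j)
  · obtain ⟨_, hxU, i, rfl⟩ := htd.inter_open_nonempty U hU hne
    exact ⟨Nat.pair i r₀, Nat.right_le_pair _ _, by simpa using hxU⟩

end Dense

/-! ### Sufficiency -/

section Sufficiency

variable {𝕜 : Type*} [RCLike 𝕜]

lemma enorm_div_le (a b : 𝕜) : ‖a / b‖ₑ ≤ ‖a‖ₑ / ‖b‖ₑ := by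
  by_cases hb : b = 0
  · simp [hb]
  · rw [ENNReal.le_div_iff_mul_le (Or.inl (enorm_ne_zero.2 hb)) (Or.inl enorm_ne_top),
      ← enorm_mul, div_mul_cancel₀ _ hb]

/-- A sequence that at each of the prescribed positions `f_t^m(j)` takes one of the prescribed
values, and that vanishes elsewhere. -/
lemma exists_sequence {N : ℕ} (f : Fin N → ℕ+ → ℕ+) (E : ℕ → Set ℕ) (l : ℕ → ℕ+)
    (v : ℕ → Fin N → ℕ+ → ℕ → 𝕜) : ∃ x : ℕ+ → 𝕜,
    (∀ i, x i ≠ 0 → ∃ q t j m, m ∈ E q ∧ j ≤ l q ∧ (f t)^[m] j = i ∧ x i = v q t j m) ∧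
    ∀ q t j m, m ∈ E q → j ≤ l q → ∃ q' t' j' m', m' ∈ E q' ∧ j' ≤ l q' ∧
      (f t')^[m'] j' = (f t)^[m] j ∧ x ((f t)^[m] j) = v q' t' j' m' := by
  classical
  have h : ∀ i, ∃ y : 𝕜,
      (y ≠ 0 → ∃ q t j m, m ∈ E q ∧ j ≤ l q ∧ (f t)^[m] j = i ∧ y = v q t j m) ∧
      ∀ q t j m, m ∈ E q → j ≤ l q → (f t)^[m] j = i → ∃ q' t' j' m', m' ∈ E q' ∧ j' ≤ l q' ∧
        (f t')^[m'] j' = i ∧ y = v q' t' j' m' := by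
    intro i
    by_cases hi : ∃ q t j m, m ∈ E q ∧ j ≤ l q ∧ (f t)^[m] j = i
    · obtain ⟨q, t, j, m, hm, hj, hi⟩ := hi
      exact ⟨v q t j m, fun _ => ⟨q, t, j, m, hm, hj, hi, rfl⟩,
        fun _ _ _ _ _ _ _ => ⟨q, t, j, m, hm, hj, hi, rfl⟩⟩
    · refine ⟨0, fun h => absurd rfl h, fun q t j m hm hj h => ?_⟩
      exact absurd ⟨q, t, j, m, hm, hj, h⟩ hi
  choose x hx hx' using h
  exact ⟨x, hx, fun q t j m hm hj => hx' _ q t j m hm hj rfl⟩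

/-- Each entry of the difference between the orbit and its target is controlled by a single
perturbing entry. -/
lemma entry_error {N : ℕ} {f : Fin N → ℕ+ → ℕ+} (hf : ∀ s, StrictMono (f s))
    (hf1 : ∀ s, 1 < f s 1) {w : Fin N → ℕ+ → 𝕜} {E : ℕ → Set ℕ} {l L : ℕ → ℕ+} {G : ℕ → ℕ}
    {δ : ℕ → ℝ} {a : ℕ → Fin N → ℕ+ → 𝕜} (ha : ∀ r s j, a r s j ≠ 0)
    (hW : ∀ s j n, weightProd (f s) (w s) j n ≠ 0)
    (hlL : ∀ r, l r ≤ L r) (hLG : ∀ r, (L r : ℕ) ≤ G r)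
    (hsep : ∀ q r, ∀ m ∈ E q, ∀ n ∈ E r, m < n → m + max (G q + 1) (G r + 1) ≤ n)
    (hdisj : ∀ q r, q ≠ r → Disjoint (E q) (E r))
    (hreg : ∀ q r, ∀ m ∈ E q, ∀ n ∈ E r, m ≠ n → ∀ s t : Fin N,
      ((f s)^[m] '' Set.Iic (L q)) ∩ ((f t)^[n] '' Set.Iic (L r)) = ∅)
    (hcomm : ∀ r, ∀ s t : Fin N, s ≠ t → ∀ n ∈ E r,
      (∀ j ∈ ((f t)^[n] '' Set.Iic (l r)) ∩ ((f s)^[n] '' Set.Iic (l r)),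
        ‖weightProd (f s) (w s) (iterInv (f s) n j) n /
            weightProd (f t) (w t) (iterInv (f t) n j) n -
          a r s (iterInv (f s) n j) / a r t (iterInv (f t) n j)‖ ≤ δ r) ∧
      (∀ j ∈ ((f t)^[n] '' Set.Iic (l r)) ∩ ((f s)^[n] '' Set.Ioi (l r)),
        ‖weightProd (f s) (w s) (iterInv (f s) n j) n‖ /
          ‖weightProd (f t) (w t) (iterInv (f t) n j) n‖ ≤ δ r))
    {x : ℕ+ → 𝕜}
    (hx : ∀ i, x i ≠ 0 → ∃ q t j m, m ∈ E q ∧ j ≤ l q ∧ (f t)^[m] j = i ∧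
      x i = a q t j / weightProd (f t) (w t) j m)
    (hx' : ∀ q t j m, m ∈ E q → j ≤ l q → ∃ q' t' j' m', m' ∈ E q' ∧ j' ≤ l q' ∧
      (f t')^[m'] j' = (f t)^[m] j ∧
      x ((f t)^[m] j) = a q' t' j' / weightProd (f t') (w t') j' m')
    {r n : ℕ} (hn : n ∈ E r) (s : Fin N) (j : ℕ+) {u : 𝕜}
    (hu : u = weightProd (f s) (w s) j n * x ((f s)^[n] j) - if j ≤ l r then a r s j else 0)
    (hu0 : u ≠ 0) :
    (∃ t j', j' ≤ l r ∧ iterInv (f s) n ((f t)^[n] j') = j ∧ ‖u‖ ≤ δ r * ‖a r t j'‖) ∨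
    (∃ q t j' m, m ∈ E q ∧ j' ≤ l q ∧ s ≠ t ∧ m ≠ n ∧
      (f t)^[m] j' ∈ (f s)^[n] '' Set.Ioi (L r) ∧ iterInv (f s) n ((f t)^[m] j') = j ∧
      u = weightProd (f s) (w s) j n * (a q t j' / weightProd (f t) (w t) j' m)) ∨
    (∃ q j', ∃ h : ℕ+, j' ≤ l q ∧ max (G q) (G r) < h ∧ (f s)^[(h : ℕ)] j' = j ∧
      u = a q s j' / weightProd (f s) (w s) j' h) := by
  have hown : ∀ q m, m ∈ E q → m = n → q = r := fun q m hm hmn => by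
    by_contra h
    exact Set.disjoint_left.1 (hdisj q r h) hm (hmn ▸ hn)
  rcases le_or_gt j (l r) with hj | hj
  · left
    obtain ⟨q, t, j', m, hm, hj', hpos, hval⟩ := hx' r s j n hn hj
    -- The entry stored at this position may stem from another prescription, but regularity forces
    -- the same time and disjointness of the E_q the same level.
    have hmn : m = n := by
      by_contra hne
      have h1 := hreg q r m hm n hn hne t s
      have h2 : (f s)^[n] j ∈ ((f t)^[m] '' Set.Iic (L q)) ∩ ((f s)^[n] '' Set.Iic (L r)) :=
        ⟨⟨j', hj'.trans (hlL q), hpos⟩, ⟨j, hj.trans (hlL r), rfl⟩⟩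
      rw [h1] at h2
      exact h2
    obtain rfl := hown q m hm hmn
    subst hmn
    rw [if_pos hj, hval] at hu
    by_cases hst : s = t
    · subst hst
      obtain rfl := ((hf s).iterate m).injective hpos
      exfalso
      refine hu0 ?_
      rw [hu]
      rw [mul_div_cancel₀ _ (hW s j' m), sub_self]
    · refine ⟨t, j', hj', by rw [hpos, iterInv_iterate (hf s)], ?_⟩
      have h1 := (hcomm q s t hst m hm).1 ((f s)^[m] j) ⟨⟨j', hj', hpos⟩, ⟨j, hj, rfl⟩⟩
      rw [iterInv_iterate (hf s), ← hpos, iterInv_iterate (hf t)] at h1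
      have h2 : u = (weightProd (f s) (w s) j m / weightProd (f t) (w t) j' m -
          a q s j / a q t j') * a q t j' := by
        rw [hu, sub_mul, div_mul_cancel₀ _ (ha q t j')]
        ring
      rw [h2, norm_mul]
      exact mul_le_mul_of_nonneg_right h1 (norm_nonneg _)
  · rw [if_neg (not_le.2 hj), sub_zero] at hu
    have hx0 : x ((f s)^[n] j) ≠ 0 := right_ne_zero_of_mul (hu ▸ hu0)
    obtain ⟨q, t, j', m, hm, hj', hpos, hval⟩ := hx _ hx0
    rw [hval] at hu
    by_cases hmn : m = n
    · left
      obtain rfl := hown q m hm hmn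
      subst hmn
      by_cases hst : s = t
      · subst hst
        obtain rfl := ((hf s).iterate m).injective hpos
        exact absurd hj' (not_le.2 hj)
      · refine ⟨t, j', hj', by rw [hpos, iterInv_iterate (hf s)], ?_⟩
        have h1 := (hcomm q s t hst m hm).2 ((f s)^[m] j) ⟨⟨j', hj', hpos⟩, ⟨j, hj, rfl⟩⟩
        rw [iterInv_iterate (hf s), ← hpos, iterInv_iterate (hf t)] at h1
        have h2 : u = weightProd (f s) (w s) j m / weightProd (f t) (w t) j' m * a q t j' := by
          rw [hu]
          ring
        rw [h2, norm_mul, norm_div]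
        exact mul_le_mul_of_nonneg_right h1 (norm_nonneg _)
    · right
      -- Regularity holds for [1, L_r] and not only for [1, l_r], which puts the position in the
      -- range where (2) and (3) apply.
      have hjL : L r < j := by
        by_contra hle
        have h1 := hreg q r m hm n hn hmn t s
        have h2 : (f s)^[n] j ∈ ((f t)^[m] '' Set.Iic (L q)) ∩ ((f s)^[n] '' Set.Iic (L r)) :=
          ⟨⟨j', hj'.trans (hlL q), hpos⟩, ⟨j, not_lt.1 hle, rfl⟩⟩
        rw [h1] at h2
        exact h2
      by_cases hst : s = t
      · right
        subst hst
        rcases lt_or_gt_of_ne hmn with hlt | hlt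
        -- An earlier time would give j' = f_s^{n-m}(j) ≥ j + (n - m) > G_q ≥ l_q.
        · exfalso
          have h1 := hsep q r m hm n hn hlt
          rw [show n = m + (n - m) by omega, Function.iterate_add_apply] at hpos
          have h2 : j' = (f s)^[n - m] j := ((hf s).iterate m).injective hpos
          have h3 := add_le_iterate (hf s) (hf1 s) (n - m) j
          rw [← h2] at h3
          have h4 : (j' : ℕ) ≤ l q := hj'
          have h5 : (l q : ℕ) ≤ L q := hlL q
          have h6 := hLG q
          have h7 := le_max_left (G q + 1) (G r + 1)
          omega
        · have h1 := hsep r q n hn m hm hlt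
          obtain ⟨h, rfl⟩ : ∃ h, m = h + n := ⟨m - n, by omega⟩
          have h7 := le_max_left (G r + 1) (G q + 1)
          have h8 := le_max_right (G r + 1) (G q + 1)
          have hpos' : (f s)^[h] j' = j := by
            rw [add_comm, Function.iterate_add_apply] at hpos
            exact ((hf s).iterate n).injective hpos
          refine ⟨q, j', ⟨h, by omega⟩, hj', ?_, hpos', ?_⟩
          · exact max_lt (show G q < h by omega) (show G r < h by omega)
          · rw [hu, weightProd_add, hpos']
            change _ = a q s j' / weightProd (f s) (w s) j' h
            rw [mul_div_assoc', mul_comm (weightProd (f s) (w s) j' h),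
              mul_div_mul_left _ _ (hW s j n)]
      · left
        exact ⟨q, t, j', m, hm, hj', hst, hmn, ⟨j, hjL, hpos.symm⟩,
          by rw [hpos, iterInv_iterate (hf s)], hu⟩


lemma tsum_enorm_tuple {p : ℝ≥0∞} [Fact (1 ≤ p)] (hp : p ≠ ⊤) {N : ℕ}
    (y : Fin N → lp (fun _ : ℕ+ => 𝕜) p) :
    ∑' q : Fin N × ℕ+, ‖y q.1 q.2‖ₑ ^ p.toReal = ∑ s, ‖y s‖ₑ ^ p.toReal := by
  rw [ENNReal.tsum_prod' (f := fun q : Fin N × ℕ+ => ‖y q.1 q.2‖ₑ ^ p.toReal), tsum_fintype]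
  exact Finset.sum_congr rfl fun s _ => tsum_enorm_rpow hp (y s)

theorem disjointHypercyclic_of_sets (p : ℝ≥0∞) [Fact (1 ≤ p)]
    (hp : p ≠ ⊤) (N : ℕ)
    (f : Fin N → ℕ+ → ℕ+) (hf : ∀ s, StrictMono (f s)) (hf1 : ∀ s, 1 < f s 1)
    (w : Fin N → ℕ+ → 𝕜) (hw : ∀ s, BddAbove (Set.range fun j => ‖w s (f s j)‖))
    (𝒜 : Set (Set ℕ)) (h𝒜 : 𝒜 = familyUBD ∨ 𝒜 = familyUD ∨ 𝒜 = familyLD)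
    (C : ℕ+ → Set ℕ) (hC : ∀ k, C k ∈ 𝒜) (ε : ℕ+ → ℝ) (hε : Tendsto ε atTop (𝓝 0))
    (hreg : ∀ l k : ℕ+, ∀ m ∈ C l, ∀ n ∈ C k, m ≠ n → ∀ s t : Fin N,
      ((f s)^[m] '' Set.Iic l) ∩ ((f t)^[n] '' Set.Iic k) = ∅)
    (hsum : ∀ (j : ℕ+) (s : Fin N),
      ∑' n : ℕ+, 1 / ‖weightProd (f s) (w s) j n‖ₑ ^ p.toReal < ⊤)
    (hcross : ∀ j l k : ℕ+, j ≤ l → ∀ n ∈ C k, ∀ s t : Fin N, s ≠ t →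
      ∑' m : {m : ℕ // m ∈ C l \ {n} ∧ (f t)^[m] j ∈ (f s)^[n] '' Set.Ioi k},
        ‖weightProd (f s) (w s) (iterInv (f s) n ((f t)^[m] j)) n‖ₑ ^ p.toReal /
          ‖weightProd (f t) (w t) j m‖ₑ ^ p.toReal ≤ ENNReal.ofReal (ε (max l k)))
    (hcomm : ∀ (l : ℕ+) (a : Fin N → ℕ+ → 𝕜), (∀ s, ∀ j ≤ l, a s j ≠ 0) →
      ∀ δ : ℝ, 0 < δ → ∃ L : ℕ+, l ≤ L ∧ ∀ s t : Fin N, s ≠ t → ∀ n ∈ C L,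
        (∀ j ∈ ((f t)^[n] '' Set.Iic l) ∩ ((f s)^[n] '' Set.Iic l),
          ‖weightProd (f s) (w s) (iterInv (f s) n j) n /
              weightProd (f t) (w t) (iterInv (f t) n j) n -
            a s (iterInv (f s) n j) / a t (iterInv (f t) n j)‖ ≤ δ) ∧
        (∀ j ∈ ((f t)^[n] '' Set.Iic l) ∩ ((f s)^[n] '' Set.Ioi l),
          ‖weightProd (f s) (w s) (iterInv (f s) n j) n‖ /
              ‖weightProd (f t) (w t) (iterInv (f t) n j) n‖ ≤ δ)) :
    DisjointHypercyclic 𝒜 (fun s => pseudoShift p (f s) (hf s) (w s) (hw s)) := by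
  classical
  have hp0 := toReal_pos_of_one_le hp
  have hp1 := one_le_toReal hp
  -- A vanishing product would contribute 1/0 = ∞ to the sum in (1).
  have hW : ∀ s j n, weightProd (f s) (w s) j n ≠ 0 := by
    intro s j n h0
    rcases Nat.eq_zero_or_pos n with rfl | hn
    · rw [weightProd_zero] at h0
      exact one_ne_zero h0
    · have h1 := ENNReal.ne_top_of_tsum_ne_top (hsum j s).ne ⟨n, hn⟩
      refine h1 ?_
      change 1 / ‖weightProd (f s) (w s) j n‖ₑ ^ p.toReal = ⊤
      rw [h0, enorm_zero, ENNReal.zero_rpow_of_pos hp0, one_div, ENNReal.inv_zero]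
  obtain ⟨a, ha0, hadense⟩ := exists_dense_nonzero (p := p) 𝕜 hp N
  set M : ℕ → ℝ≥0∞ := fun r => ∑ s, ‖a r s‖ₑ ^ p.toReal with hMdef
  have hM : ∀ r, M r ≠ ⊤ := fun r => (ENNReal.sum_lt_top.2 fun s _ =>
    ENNReal.rpow_lt_top_of_nonneg hp0.le enorm_ne_top).ne
  set τ : ℕ → ℕ+ → ℝ≥0∞ := fun r l => ∑' q : Fin N × ℕ+,
    if (l : ℕ) < (q.2 : ℕ) then ‖a r q.1 q.2‖ₑ ^ p.toReal else 0
  have hcoe : Tendsto (fun l : ℕ+ => (l : ℕ)) atTop atTop :=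
    tendsto_atTop_atTop.2 fun b => ⟨b.succPNat, fun c hc => by
      have h1 : b + 1 ≤ (c : ℕ) := by simpa using PNat.coe_le_coe _ _ |>.2 hc
      omega⟩
  have hτ : ∀ r, Tendsto (τ r) atTop (𝓝 0) := fun r =>
    (tendsto_tsum_tail (g := fun q : Fin N × ℕ+ => ‖a r q.1 q.2‖ₑ ^ p.toReal)
      (by rw [tsum_enorm_tuple hp]; exact hM r) (fun q => (q.2 : ℕ))).comp hcoe
  -- These are the p-th powers of all entries that level q could place at any time; their sum is
  -- finite by (1), and κ is its tail over late times.
  set b : ℕ → ℕ+ → Fin N × ℕ+ × ℕ+ → ℝ≥0∞ := fun q l ω =>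
    if ω.2.1 ≤ l then ‖a q ω.1 ω.2.1‖ₑ ^ p.toReal *
      (1 / ‖weightProd (f ω.1) (w ω.1) ω.2.1 ω.2.2‖ₑ ^ p.toReal) else 0 with hb
  have hbfin : ∀ q l, ∑' ω, b q l ω ≠ ⊤ := by
    intro q l
    rw [ENNReal.tsum_prod', tsum_fintype]
    refine (ENNReal.sum_lt_top.2 fun s _ => ?_).ne
    rw [ENNReal.tsum_prod', tsum_eq_sum (s := Finset.Iic l) fun j hj => ?_]
    · refine ENNReal.sum_lt_top.2 fun j hj => ?_
      simp only [hb, Finset.mem_Iic.1 hj, if_true]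
      rw [ENNReal.tsum_mul_left]
      exact ENNReal.mul_lt_top (ENNReal.rpow_lt_top_of_nonneg hp0.le enorm_ne_top) (hsum j s)
    · have : ¬ j ≤ l := fun h => hj (Finset.mem_Iic.2 h)
      simp [hb, this]
  set κ : ℕ → ℕ+ → ℕ → ℝ≥0∞ := fun q l g => ∑' ω : Fin N × ℕ+ × ℕ+,
    if g < (ω.2.2 : ℕ) then b q l ω else 0
  have hκ : ∀ q l, Tendsto (κ q l) atTop (𝓝 0) := fun q l =>
    tendsto_tsum_tail (hbfin q l) fun ω => (ω.2.2 : ℕ)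
  have he : Tendsto (fun k => ENNReal.ofReal (ε k)) atTop (𝓝 0) := by
    simpa using ENNReal.tendsto_ofReal hε
  obtain ⟨l, L, G, δ, hG, hpar, hpar2⟩ := exists_parameters hM he hτ hκ
    (P := fun r l δ L => ∀ s t : Fin N, s ≠ t → ∀ n ∈ C L,
        (∀ j ∈ ((f t)^[n] '' Set.Iic l) ∩ ((f s)^[n] '' Set.Iic l),
          ‖weightProd (f s) (w s) (iterInv (f s) n j) n /
              weightProd (f t) (w t) (iterInv (f t) n j) n -
            a r s (iterInv (f s) n j) / a r t (iterInv (f t) n j)‖ ≤ δ) ∧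
        (∀ j ∈ ((f t)^[n] '' Set.Iic l) ∩ ((f s)^[n] '' Set.Ioi l),
          ‖weightProd (f s) (w s) (iterInv (f s) n j) n‖ /
              ‖weightProd (f t) (w t) (iterInv (f t) n j) n‖ ≤ δ))
    (fun r l δ hδ => hcomm l (fun s j => a r s j) (fun s j _ => ha0 r s j) δ hδ) hp0
  obtain ⟨E, hE𝒜, hEsub, hEsep, hEdisj⟩ := exists_separated h𝒜
    (fun r => C (L r) \ Set.Iio (G r + 1)) (fun r => diff_Iio_mem_family h𝒜 (hC _) _)
    (fun r => G r + 1) (fun _ _ h => Nat.add_le_add_right (hG h) 1)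
  have hEC : ∀ r, ∀ n ∈ E r, n ∈ C (L r) := fun r n hn => (hEsub r hn).1
  have hEG : ∀ r, ∀ n ∈ E r, G r < n := fun r n hn =>
    Nat.lt_of_succ_le (not_lt.1 (hEsub r hn).2)
  obtain ⟨x, hx, hx'⟩ := exists_sequence f E l
    (fun q t j m => a q t j / weightProd (f t) (w t) j m)
  have hval : ∀ q t j (h : ℕ+) (y : 𝕜), j ≤ l q → y = a q t j / weightProd (f t) (w t) j h →
      ‖y‖ₑ ^ p.toReal ≤ b q (l q) (t, j, h) := by
    rintro q t j h _ hj rfl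
    simp only [hb, hj, if_true]
    rw [mul_one_div, ← ENNReal.div_rpow_of_nonneg _ _ hp0.le]
    exact ENNReal.rpow_le_rpow (enorm_div_le _ _) hp0.le
  -- Level q places entries only at times beyond G_q, so its total contribution is a tail of size at
  -- most 2^{-q}.
  have hxmem : Memℓp x p := by
    refine memℓp_of_tsum_enorm_lt_top hp (lt_of_le_of_lt (tsum_le_tsum_of_cover
      (fun ω : ℕ × Fin N × ℕ+ × ℕ+ => if G ω.1 < (ω.2.2.2 : ℕ) then b ω.1 (l ω.1) ω.2 else 0)
      (fun ω => (f ω.2.1)^[ω.2.2.2] ω.2.2.1) fun i hi => ?_) ?_)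
    · have hi0 : x i ≠ 0 := fun h => hi (by simp [h, hp0])
      obtain ⟨q, t, j, m, hm, hj, hpos, hxi⟩ := hx i hi0
      have hGm := hEG q m hm
      refine ⟨(q, t, j, ⟨m, by omega⟩), hpos, ?_⟩
      simp only [PNat.mk_coe, hGm, if_true]
      exact hval q t j ⟨m, by omega⟩ _ hj hxi
    · rw [ENNReal.tsum_prod']
      refine lt_of_le_of_lt (ENNReal.tsum_le_tsum (g := fun q => 2⁻¹ ^ (q + 0)) fun q => ?_) ?_
      · have h1 := (hpar2 q q).2
        rw [max_self] at h1
        exact h1.trans (pow_le_pow_right_of_le_one' (by simp) (by omega))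
      · rw [tsum_two_inv_pow_add]
        simp
  -- The constant is 5 = 1 + 2 + 2: collisions at time n, then the other two causes, each summed
  -- over q as a geometric series.
  have hmain : ∀ r, ∀ n ∈ E r, ∀ s, ∑' j, ‖weightProd (f s) (w s) j n * x ((f s)^[n] j) -
      (if j ≤ l r then a r s j else 0)‖ₑ ^ p.toReal ≤ 5 * 2⁻¹ ^ r := by
    intro r n hn s
    set S : ℕ → Fin N → ℕ+ → Set ℕ := fun q t j =>
      {m : ℕ | m ∈ C (L q) \ {n} ∧ (f t)^[m] j ∈ (f s)^[n] '' Set.Ioi (L r)} with hS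
    set R : Fin N → ℕ+ → ℕ → ℝ≥0∞ := fun t j m =>
      ‖weightProd (f s) (w s) (iterInv (f s) n ((f t)^[m] j)) n‖ₑ ^ p.toReal /
        ‖weightProd (f t) (w t) j m‖ₑ ^ p.toReal with hR
    refine (tsum_le_tsum_of_cover₃
      (fun ω : Fin N × ℕ+ => ENNReal.ofReal (δ r) ^ p.toReal * ‖a r ω.1 ω.2‖ₑ ^ p.toReal)
      (fun ω : ℕ × (Fin N × ℕ+) × ℕ => if ω.2.1.2 ≤ l ω.1 ∧ s ≠ ω.2.1.1 then
        ‖a ω.1 ω.2.1.1 ω.2.1.2‖ₑ ^ p.toReal *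
          (S ω.1 ω.2.1.1 ω.2.1.2).indicator (R ω.2.1.1 ω.2.1.2) ω.2.2 else 0)
      (fun ω : ℕ × Fin N × ℕ+ × ℕ+ =>
        if max (G ω.1) (G r) < (ω.2.2.2 : ℕ) then b ω.1 (l ω.1) ω.2 else 0)
      (fun ω => iterInv (f s) n ((f ω.1)^[n] ω.2))
      (fun ω => iterInv (f s) n ((f ω.2.1.1)^[ω.2.2] ω.2.1.2))
      (fun ω => (f ω.2.1)^[ω.2.2.2] ω.2.2.1) fun j hj => ?_).trans ?_
    · have hu0 : weightProd (f s) (w s) j n * x ((f s)^[n] j) -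
          (if j ≤ l r then a r s j else 0) ≠ 0 := fun h => hj (by simp [h, hp0])
      rcases entry_error (a := fun r s j => a r s j) hf hf1 ha0 hW (fun r => (hpar r).1)
        (fun r => (hpar r).2.1) hEsep hEdisj
        (fun q r m hm n hn => hreg _ _ m (hEC q m hm) n (hEC r n hn))
        (fun r s t hst n hn => (hpar r).2.2.2.2 s t hst n (hEC r n hn)) hx hx' hn s j rfl hu0
        with ⟨t, j', hj', hpos, hle⟩ | ⟨q, t, j', m, hm, hj', hst, hmn, hmem, hpos, hu⟩ |
          ⟨q, j', h, hj', hG', hpos, hu⟩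
      · refine Or.inl ⟨(t, j'), hpos, ?_⟩
        simp only
        rw [← ENNReal.mul_rpow_of_nonneg _ _ hp0.le]
        refine ENNReal.rpow_le_rpow ?_ hp0.le
        have hδ0 : 0 ≤ δ r := by
          by_contra hneg
          have h1 : δ r * ‖a r t j'‖ < 0 :=
            mul_neg_of_neg_of_pos (not_le.1 hneg) (norm_pos_iff.2 (ha0 r t j'))
          exact absurd (hle.trans_lt h1) (not_lt.2 (norm_nonneg _))
        rw [← ofReal_norm (a r t j'), ← ofReal_norm, ← ENNReal.ofReal_mul hδ0]
        exact ENNReal.ofReal_le_ofReal hle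
      · refine Or.inr (Or.inl ⟨(q, (t, j'), m), hpos, ?_⟩)
        have hmS : m ∈ S q t j' := ⟨⟨hEC q m hm, hmn⟩, hmem⟩
        simp only [hj', hst, ne_eq, not_false_eq_true, and_self, if_true]
        rw [Set.indicator_of_mem hmS, hu]
        simp only [hR, hpos]
        rw [enorm_mul, ← ENNReal.div_rpow_of_nonneg _ _ hp0.le,
          ← ENNReal.mul_rpow_of_nonneg _ _ hp0.le]
        refine ENNReal.rpow_le_rpow ?_ hp0.le
        refine (mul_le_mul_right (enorm_div_le _ _) _).trans (le_of_eq ?_)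
        simp only [div_eq_mul_inv]
        ring
      · refine Or.inr (Or.inr ⟨(q, s, j', h), hpos, ?_⟩)
        simp only [hG', if_true]
        exact hval q s j' h _ hj' hu
    · have e1 : ∑' ω : Fin N × ℕ+, ENNReal.ofReal (δ r) ^ p.toReal *
          ‖a r ω.1 ω.2‖ₑ ^ p.toReal ≤ 2⁻¹ ^ r := by
        rw [ENNReal.tsum_mul_left, tsum_enorm_tuple hp]
        exact (hpar r).2.2.2.1
      have e2 : ∑' ω : ℕ × (Fin N × ℕ+) × ℕ, (if ω.2.1.2 ≤ l ω.1 ∧ s ≠ ω.2.1.1 then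
          ‖a ω.1 ω.2.1.1 ω.2.1.2‖ₑ ^ p.toReal *
            (S ω.1 ω.2.1.1 ω.2.1.2).indicator (R ω.2.1.1 ω.2.1.2) ω.2.2 else 0) ≤
          2 * 2⁻¹ ^ r := by
        rw [ENNReal.tsum_prod', ← tsum_two_inv_pow_add]
        refine ENNReal.tsum_le_tsum fun q => le_trans ?_ (hpar2 q r).1
        rw [ENNReal.tsum_prod', hMdef]
        simp only
        rw [← tsum_enorm_tuple hp, ← ENNReal.tsum_mul_right]
        refine ENNReal.tsum_le_tsum fun ω => ?_
        by_cases h1 : ω.2 ≤ l q ∧ s ≠ ω.1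
        · refine (le_of_eq (tsum_congr fun m => if_pos h1)).trans ?_
          rw [ENNReal.tsum_mul_left, ← tsum_subtype]
          exact mul_le_mul_right (hcross ω.2 (L q) (L r) (h1.1.trans (hpar q).1) n
            (hEC r n hn) s ω.1 h1.2) _
        · simp only [h1, if_false, tsum_zero]
          exact zero_le
      have e3 : ∑' ω : ℕ × Fin N × ℕ+ × ℕ+,
          (if max (G ω.1) (G r) < (ω.2.2.2 : ℕ) then b ω.1 (l ω.1) ω.2 else 0) ≤
          2 * 2⁻¹ ^ r := by
        rw [ENNReal.tsum_prod', ← tsum_two_inv_pow_add]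
        exact ENNReal.tsum_le_tsum fun q => (hpar2 q r).2
      refine (add_le_add (add_le_add e1 e2) e3).trans (le_of_eq ?_)
      ring
  set X : lp (fun _ : ℕ+ => 𝕜) p := ⟨x, hxmem⟩ with hX
  -- Convexity of the p-th power gives 2^{p-1}; 6 adds to 5 the part of the target beyond l_r.
  set K : ℝ≥0∞ := 2 ^ (p.toReal - 1) * 6 with hK
  have hKtop : K ≠ ⊤ := ENNReal.mul_ne_top
    (ENNReal.rpow_ne_top_of_nonneg (by linarith) (by simp)) (by simp)
  have hdist : ∀ r, ∀ n ∈ E r, ∀ s,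
      ‖(pseudoShift p (f s) (hf s) (w s) (hw s) ^ n) X - a r s‖ₑ ^ p.toReal ≤ K * 2⁻¹ ^ r := by
    intro r n hn s
    rw [← tsum_enorm_rpow hp]
    have h1 : ∀ j, ‖((pseudoShift p (f s) (hf s) (w s) (hw s) ^ n) X - a r s) j‖ₑ ^ p.toReal ≤
        2 ^ (p.toReal - 1) * (‖weightProd (f s) (w s) j n * x ((f s)^[n] j) -
          (if j ≤ l r then a r s j else 0)‖ₑ ^ p.toReal +
          if (l r : ℕ) < (j : ℕ) then ‖a r s j‖ₑ ^ p.toReal else 0) := by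
      intro j
      set u := weightProd (f s) (w s) j n * x ((f s)^[n] j) -
        (if j ≤ l r then a r s j else 0) with hu
      have h2 : ((pseudoShift p (f s) (hf s) (w s) (hw s) ^ n) X - a r s) j =
          u - if j ≤ l r then 0 else a r s j := by
        rw [lp.coeFn_sub, Pi.sub_apply, pseudoShift_pow_apply, hu]
        change weightProd (f s) (w s) j n * x ((f s)^[n] j) - _ = _
        split_ifs <;> ring
      have h3 : (if (l r : ℕ) < (j : ℕ) then ‖a r s j‖ₑ ^ p.toReal else 0) =
          ‖if j ≤ l r then 0 else a r s j‖ₑ ^ p.toReal := by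
        by_cases hj : j ≤ l r
        · have h4 : ¬ (l r : ℕ) < (j : ℕ) := not_lt.2 hj
          simp [hj, h4, hp0]
        · have h4 : (l r : ℕ) < (j : ℕ) := not_le.1 hj
          simp only [hj, h4, if_true, if_false]
      rw [h2, h3]
      exact (ENNReal.rpow_le_rpow enorm_sub_le hp0.le).trans
        (ENNReal.rpow_add_le_mul_rpow_add_rpow _ _ hp1)
    refine (ENNReal.tsum_le_tsum h1).trans ?_
    rw [ENNReal.tsum_mul_left, ENNReal.tsum_add, hK, mul_assoc]
    refine mul_le_mul_right ?_ _
    have h2 : ∑' j : ℕ+, (if (l r : ℕ) < (j : ℕ) then ‖a r s j‖ₑ ^ p.toReal else 0) ≤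
        2⁻¹ ^ r := by
      refine le_trans ?_ (hpar r).2.2.1
      exact ENNReal.tsum_comp_le_tsum_of_injective (f := fun j : ℕ+ => (s, j))
        (fun i j h => (Prod.ext_iff.1 h).2) (fun q : Fin N × ℕ+ =>
          if (l r : ℕ) < (q.2 : ℕ) then ‖a r q.1 q.2‖ₑ ^ p.toReal else 0)
    refine (add_le_add (hmain r n hn s) h2).trans (le_of_eq ?_)
    ring
  refine ⟨X, fun U hU hne => ?_⟩
  obtain ⟨y, hy⟩ := hne
  obtain ⟨ρ, hρ, hball⟩ := Metric.isOpen_iff.1 hU y hy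
  have hlim : Tendsto (fun r : ℕ => K * 2⁻¹ ^ r) atTop (𝓝 0) := by
    have h1 := ENNReal.tendsto_pow_atTop_nhds_zero_of_lt_one (r := 2⁻¹)
      ENNReal.one_half_lt_one
    simpa using ENNReal.Tendsto.const_mul h1 (Or.inr hKtop)
  have hρ' : (0 : ℝ≥0∞) < ENNReal.ofReal (ρ / 2) ^ p.toReal :=
    ENNReal.rpow_pos (ENNReal.ofReal_pos.2 (by positivity)) ENNReal.ofReal_ne_top
  obtain ⟨r₀, hr₀⟩ := eventually_atTop.1 (hlim.eventually (gt_mem_nhds hρ'))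
  obtain ⟨r, hr, har⟩ := hadense (Metric.ball y (ρ / 2)) Metric.isOpen_ball
    ⟨y, Metric.mem_ball_self (by positivity)⟩ r₀
  refine family_mono h𝒜 (hE𝒜 r) fun n hn => hball ?_
  rw [Metric.mem_ball, dist_pi_lt_iff (by positivity)] at har ⊢
  intro s
  rw [piMap_pow_apply]
  have h1 : ‖(pseudoShift p (f s) (hf s) (w s) (hw s) ^ n) X - a r s‖ < ρ / 2 := by
    have h2 := (hdist r n hn s).trans_lt (hr₀ r hr)
    rw [ENNReal.rpow_lt_rpow_iff hp0, ← ofReal_norm,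
      ENNReal.ofReal_lt_ofReal_iff (by positivity)] at h2
    exact h2
  rw [← dist_eq_norm] at h1
  exact (dist_triangle _ _ _).trans_lt (by linarith [har s])

end Sufficiency

end DisjointShifts

/-- Regularity enters only the sufficiency. Conditions (2), (3) and (4) survive passing to subsets,
since the sums shrink; (2) for k ≤ l and (3) for l < k merge into one bound by ε at max(l, k). -/
theorem mainTheorem2 {𝕜 : Type*} [RCLike 𝕜] (p : ℝ≥0∞) [Fact (1 ≤ p)] (hp : p ≠ ⊤)
    (N : ℕ) (hN : 2 ≤ N)
    (f : Fin N → ℕ+ → ℕ+) (hf : ∀ s, StrictMono (f s)) (hf1 : ∀ s, 1 < f s 1)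
    (w : Fin N → ℕ+ → 𝕜) (hw : ∀ s, BddAbove (Set.range fun j => ‖w s (f s j)‖))
    (𝒜 : Set (Set ℕ))
    (h𝒜 : 𝒜 = DisjointShifts.familyUBD ∨ 𝒜 = DisjointShifts.familyUD ∨
      𝒜 = DisjointShifts.familyLD)
    (hreg : DisjointShifts.WeaklyPartitionRegular 𝒜 f) :
    DisjointShifts.DisjointHypercyclic 𝒜
        (fun s => DisjointShifts.pseudoShift p (f s) (hf s) (w s) (hw s)) ↔
      ∃ (A : ℕ+ → Set ℕ) (ε : ℕ+ → ℝ),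
        (∀ k, A k ∈ 𝒜) ∧ (∀ k, 0 < ε k) ∧ Tendsto ε atTop (𝓝 0) ∧
        -- (1)
        (∀ (j : ℕ+) (s : Fin N),
          ∑' n : ℕ+, 1 / ‖DisjointShifts.weightProd (f s) (w s) j n‖ₑ ^ p.toReal < ⊤) ∧
        -- (2)
        (∀ j l : ℕ+, j ≤ l → ∀ k : ℕ+, ∀ n ∈ A k, ∀ s t : Fin N, s ≠ t →
          ∑' m : {m : ℕ // m ∈ A l \ {n} ∧ (f t)^[m] j ∈ (f s)^[n] '' Set.Ioi k},
            ‖DisjointShifts.weightProd (f s) (w s)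
                (DisjointShifts.iterInv (f s) n ((f t)^[m] j)) n‖ₑ ^ p.toReal /
              ‖DisjointShifts.weightProd (f t) (w t) j m‖ₑ ^ p.toReal ≤
            ENNReal.ofReal (ε l)) ∧
        -- (3)
        (∀ j k l : ℕ+, j ≤ k → k < l → ∀ n ∈ A l, ∀ s t : Fin N, s ≠ t →
          ∑' m : {m : ℕ // m ∈ A k ∧ (f t)^[m] j ∈ (f s)^[n] '' Set.Ioi l},
            ‖DisjointShifts.weightProd (f s) (w s)
                (DisjointShifts.iterInv (f s) n ((f t)^[m] j)) n‖ₑ ^ p.toReal /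
              ‖DisjointShifts.weightProd (f t) (w t) j m‖ₑ ^ p.toReal ≤
            ENNReal.ofReal (ε l)) ∧
        -- (4)
        (∀ (l : ℕ+) (a : Fin N → ℕ+ → 𝕜), (∀ s, ∀ j ≤ l, a s j ≠ 0) →
          ∀ δ : ℝ, 0 < δ → ∃ L : ℕ+, l ≤ L ∧ ∀ s t : Fin N, s ≠ t → ∀ n ∈ A L,
            (∀ j ∈ ((f t)^[n] '' Set.Iic l) ∩ ((f s)^[n] '' Set.Iic l),
              ‖DisjointShifts.weightProd (f s) (w s) (DisjointShifts.iterInv (f s) n j) n /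
                  DisjointShifts.weightProd (f t) (w t) (DisjointShifts.iterInv (f t) n j) n -
                a s (DisjointShifts.iterInv (f s) n j) /
                  a t (DisjointShifts.iterInv (f t) n j)‖ ≤ δ) ∧
            (∀ j ∈ ((f t)^[n] '' Set.Iic l) ∩ ((f s)^[n] '' Set.Ioi l),
              ‖DisjointShifts.weightProd (f s) (w s) (DisjointShifts.iterInv (f s) n j) n‖ /
                  ‖DisjointShifts.weightProd (f t) (w t)
                    (DisjointShifts.iterInv (f t) n j) n‖ ≤ δ)) := by
  constructor
  · exact DisjointShifts.exists_sets_of_disjointHypercyclic p hp N f hf hf1 w hw 𝒜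
      (DisjointShifts.family_subset_familyUBD h𝒜)
  · rintro ⟨A, ε, hA, -, hε, h1, h2, h3, h4⟩
    obtain ⟨C, hC, hCA, hCreg⟩ := hreg A hA
    refine DisjointShifts.disjointHypercyclic_of_sets p hp N f hf hf1 w hw 𝒜 h𝒜 C hC ε hε hCreg
      h1 ?_ ?_
    · intro j l k hj n hn s t hst
      rcases le_or_gt k l with hkl | hkl
      · rw [max_eq_left hkl]
        refine le_trans ?_ (h2 j l hj k n (hCA k hn) s t hst)
        exact ENNReal.tsum_comp_le_tsum_of_injective
          (f := fun m : {m : ℕ // m ∈ C l \ {n} ∧ (f t)^[m] j ∈ (f s)^[n] '' Set.Ioi k} =>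
            (⟨m.1, ⟨hCA l m.2.1.1, m.2.1.2⟩, m.2.2⟩ :
              {m : ℕ // m ∈ A l \ {n} ∧ (f t)^[m] j ∈ (f s)^[n] '' Set.Ioi k}))
          (fun a b h => Subtype.ext (Subtype.mk.inj h)) _
      · rw [max_eq_right hkl.le]
        refine le_trans ?_ (h3 j l k hj hkl n (hCA k hn) s t hst)
        exact ENNReal.tsum_comp_le_tsum_of_injective
          (f := fun m : {m : ℕ // m ∈ C l \ {n} ∧ (f t)^[m] j ∈ (f s)^[n] '' Set.Ioi k} =>
            (⟨m.1, hCA l m.2.1.1, m.2.2⟩ :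
              {m : ℕ // m ∈ A l ∧ (f t)^[m] j ∈ (f s)^[n] '' Set.Ioi k}))
          (fun a b h => Subtype.ext (Subtype.mk.inj h)) _
    · intro l a ha δ hδ
      obtain ⟨L, hL, h⟩ := h4 l a ha δ hδ
      exact ⟨L, hL, fun s t hst n hn => h s t hst n (hCA L hn)⟩
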